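/- Let $n,m\ge 0$ be integers and let $\mu$ be a partition. For a partition $\lambda$ of length $\ell(\lambda)$ and $N \ge 0$ let $s_\lambda(x_1,\dots,x_N)=\sum_{T} x^{\mathrm{wt}(T)}$ be the Schur polynomial, the sum being over the set $\mathrm{SSYT}_N(\lambda)$ of semistandard Young tableaux of shape $\lambda$ with entries in an $N$-letter alphabet. For a partition $\nu$ let $s_\nu[s_\mu](x_1,\dots,x_n)$ be the plethysm, i.e. the polynomial obtained from the Schur polynomial $s_\nu$ in $|\mathrm{SSYT}_n(\mu)|$ variables by substituting for these variables the monomials $x^{\mathrm{wt}(T)}$, $T\in\mathrm{SSYT}_n(\mu)$. The $\mathrm{GL}_n$-plethysm coefficients $\mathsf a^\lambda_{\nu[\mu]}\in\mathbb Z$ are defined by the (unique, finite) expansion $$s_\nu[s_\mu](x_1,\dots,x_n)=\sum_{\ell(\lambda)\le n}\mathsf a^\lambda_{\nu[\mu]}\,s_\lambda(x_1,\dots,x_n).$$ Then the following hold. 1. The coefficients $\mathsf a^\lambda_{\nu[\mu]}$ are well defined: for every partition $\nu$ an expansion as above exists and is unique. 2. The multivariate generating function $$\mathbb A_\mu(x_1,\dots,x_n;y_1,\dots,y_m)=\sum_{\ell(\lambda)\le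 n}\ \sum_{\ell(\nu)\le m}\mathsf a^\lambda_{\nu[\mu]}\,x^\lambda y^\nu,\qquad x^\lambda=x_1^{\lambda_1}\cdots x_n^{\lambda_n},\quad y^\nu=y_1^{\nu_1}\cdots y_m^{\nu_m},$$ is rational: there are polynomials $P,Q\in\mathbb Q[x_1,\dots,x_n,y_1,\dots,y_m]$ with $Q(0)\neq 0$ and $Q\cdot\mathbb A_\mu=P$ as formal power series. 3. In particular, the $\mathrm{GL}_n$-plethysm coefficients satisfy a linear recurrence with constant coefficients. Extend the notation by $\mathsf a^\gamma_{\delta[\mu]}:=0$ for $(\gamma,\delta)\in\mathbb Z^n\times\mathbb Z^m$ unless $\gamma$ and $\delta$ are both partitions (padded with zeros). Then there are a finite set $S\subset\mathbb Z_{\ge0}^n\times\mathbb Z_{\ge0}^m$ with $(0,0)\notin S$ and numbers $c_{\alpha,\beta}\in\mathbb Q$ for $(\alpha,\beta)\in S$ such that $$\mathsf a^\gamma_{\delta[\mu]}=\sum_{(\alpha,\beta)\in S}c_{\alpha,\beta}\;\mathsf a^{\gamma-\alpha}_{(\delta-\beta)[\mu]}$$ for all but finitely many $(\gamma,\delta)\in\mathbb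 Z^n\times\mathbb Z^m$. -/

import Mathlib

noncomputable section

/-- Partitions `λ` with at most `n` parts, as Young diagrams: `λ.rowLen i` is the part `λ_{i+1}`
(zero beyond the length), and `λ.colLen 0` is the length `ℓ(λ)`. -/
abbrev PartitionLE (n : ℕ) : Type := {lam : YoungDiagram // lam.colLen 0 ≤ n}

/-- `SSYT_n(λ)`: semistandard Young tableaux of shape `λ` over the alphabet `{0, …, n - 1}`. -/
abbrev BoundedSSYT (lam : YoungDiagram) (n : ℕ) : Type :=
  {T : SemistandardYoungTableau lam // ∀ i j, (i, j) ∈ lam → T i j < n}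

instance BoundedSSYT.finite (lam : YoungDiagram) (n : ℕ) : Finite (BoundedSSYT lam n) := by
  refine Finite.of_injective
    (fun (T : BoundedSSYT lam n) (c : lam.cells) =>
      (⟨T.1 c.1.1 c.1.2, T.2 _ _ ((YoungDiagram.mem_cells _).1 c.2)⟩ : Fin n)) ?_
  intro T T' h
  apply Subtype.ext
  ext i j
  by_cases hij : (i, j) ∈ lam
  · exact congrArg Fin.val (congrFun h ⟨(i, j), (YoungDiagram.mem_cells _).2 hij⟩)
  · rw [T.1.zeros hij, T'.1.zeros hij]

instance BoundedSSYT.fintype (lam : YoungDiagram) (n : ℕ) : Fintype (BoundedSSYT lam n) :=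
  Fintype.ofFinite _

/-- The monomial `x^{wt(T)} = x_0^{α_0} ⋯ x_{n-1}^{α_{n-1}}`, where `α_i` is the number of
letters `i` in `T`, written as the product of `x_{T(c)}` over the cells `c` of the shape. -/
def BoundedSSYT.weightMonomial {lam : YoungDiagram} {n : ℕ} (T : BoundedSSYT lam n) :
    MvPolynomial (Fin n) ℤ :=
  ∏ c : lam.cells,
    MvPolynomial.X ⟨T.1 c.1.1 c.1.2, T.2 _ _ ((YoungDiagram.mem_cells _).1 c.2)⟩

/-- The Schur polynomial `s_λ(x_0, …, x_{n-1})`. -/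
def schurPoly (lam : YoungDiagram) (n : ℕ) : MvPolynomial (Fin n) ℤ :=
  ∑ T : BoundedSSYT lam n, T.weightMonomial

/-- The plethysm `s_ν[s_μ](x_0, …, x_{n-1})`: the monomials `x^{wt(T)}`, `T ∈ SSYT_n(μ)`, of
`s_μ(x_0, …, x_{n-1})` are substituted for the variables of the Schur polynomial `s_ν` in
`|SSYT_n(μ)|` variables. (Schur polynomials are symmetric, so the enumeration of the tableaux
does not matter.) -/
def schurPlethysm (nu mu : YoungDiagram) (n : ℕ) : MvPolynomial (Fin n) ℤ :=
  MvPolynomial.aeval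
    (fun k : Fin (Fintype.card (BoundedSSYT mu n)) =>
      ((Fintype.equivFin (BoundedSSYT mu n)).symm k).weightMonomial)
    (schurPoly nu (Fintype.card (BoundedSSYT mu n)))

/-- `f = ∑_{ℓ(λ) ≤ n} c_λ s_λ(x_0, …, x_{n-1})` (a finite sum). -/
def IsSchurExpansion {n : ℕ} (f : MvPolynomial (Fin n) ℤ) (c : PartitionLE n →₀ ℤ) : Prop :=
  f = c.sum fun lam a => a • schurPoly lam.1 n

open Classical in
/-- The family `λ ↦ a^λ_{ν[μ]}` of `GL_n`-plethysm coefficients: the coefficients of the expansion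
`s_ν[s_μ] = ∑_λ a^λ_{ν[μ]} s_λ` in `n` variables. -/
def plethysmCoeff (n : ℕ) (nu mu : YoungDiagram) : PartitionLE n →₀ ℤ :=
  if h : ∃ c, IsSchurExpansion (schurPlethysm nu mu n) c then h.choose else 0

/-- The exponent of the monomial `x^λ y^ν = x_1^{λ_1} ⋯ x_n^{λ_n} y_1^{ν_1} ⋯ y_m^{ν_m}`. -/
def pairExponent {n m : ℕ} (lam : PartitionLE n) (nu : PartitionLE m) : (Fin n ⊕ Fin m) →₀ ℕ :=
  Finsupp.equivFunOnFinite.symm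
    (Sum.elim (fun i : Fin n => lam.1.rowLen i) (fun j : Fin m => nu.1.rowLen j))

/-- The formal power series `𝔸_μ(x; y) = ∑_{ℓ(λ) ≤ n} ∑_{ℓ(ν) ≤ m} a^λ_{ν[μ]} x^λ y^ν`. The sum is
taken coefficient by coefficient; distinct pairs `(λ, ν)` give distinct monomials, so each of these
sums has at most one nonzero term. -/
def plethysmSeries (n m : ℕ) (mu : YoungDiagram) : MvPowerSeries (Fin n ⊕ Fin m) ℚ :=
  fun d => ∑ᶠ p : PartitionLE n × PartitionLE m,
    MvPowerSeries.coeff d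
      (MvPowerSeries.monomial (pairExponent p.1 p.2) (plethysmCoeff n p.2.1 mu p.1 : ℚ))

/-- A formal power series over `ℚ` is rational if it is the expansion at the origin of a quotient
`P / Q` of polynomials, where `Q` does not vanish at the origin. -/
def IsRationalSeries {σ : Type*} (F : MvPowerSeries σ ℚ) : Prop :=
  ∃ P Q : MvPolynomial σ ℚ, MvPolynomial.constantCoeff Q ≠ 0 ∧
    (Q : MvPowerSeries σ ℚ) * F = (P : MvPowerSeries σ ℚ)

open Classical in
/-- `a^γ_{δ[μ]}` for integer vectors `γ`, `δ`: it is `a^λ_{ν[μ]}` if `γ = (λ_1, …, λ_n)` and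
`δ = (ν_1, …, ν_m)` for (necessarily unique) partitions `λ`, `ν`, and zero otherwise. -/
def plethysmCoeffVec {n m : ℕ} (mu : YoungDiagram) (γ : Fin n → ℤ) (δ : Fin m → ℤ) : ℤ :=
  ∑ᶠ p : PartitionLE n × PartitionLE m,
    if (∀ i, γ i = p.1.1.rowLen i) ∧ (∀ j, δ j = p.2.1.rowLen j)
    then plethysmCoeff n p.2.1 mu p.1 else 0

end

/-!
The generating function of the plethysm coefficients is a coefficient extraction from the Cauchy
kernel `K = ∏_{T,j} 1 / (1 - x^{wt(T)} y_j)`, where `T` runs through the tableaux of shape `μ` on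
`n` letters and `j` through `1, …, m`.

Let `a_ρ` be the Vandermonde determinant. Expanding `a_ρ(y) K` with respect to `y`, the coefficient
at `y^{ν+ρ}` is the Jacobi–Trudi determinant of the complete homogeneous polynomials evaluated at
the monomials `x^{wt(T)}`, that is, `s_ν[s_μ](x)`. By the bialternant formula
`a_ρ s_λ = a_{λ+ρ}`, the coefficient of `x^{λ+ρ}` in `a_ρ(x) s_ν[s_μ](x)` is `a^λ_{ν[μ]}`. So
`x^ρ y^ρ 𝔸_μ` is the part of `a_ρ(x) a_ρ(y) K` supported on the exponents that decrease strictly in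
both groups of variables (`restrictExponents_alternatingKernel`).

Rationality follows because the span of the series `x^c / ∏_a (1 - x^a)` is stable under restriction
of the exponents to an affine half-space (`restrictExponents_fracTerm_mem`). This is proved by
Elliott's reduction: the identity `1 / ((1-u)(1-v)) = (1/(1-u) + 1/(1-v) - 1) / (1 - u v)` removes
pairs of factors on which the linear form takes opposite signs. Comparing coefficients in
`Q 𝔸_μ = P` gives the recurrence.

The Jacobi–Trudi formula for the tableau definition (`sum_tableauProd_eq_det`) holds because both
sides satisfy the same branching rule: removing the largest letter of a tableau leaves a tableau
whose shape interlaces the original one, and the determinant satisfies the same recursion by row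
operations and multilinearity (`det_branching`). The bialternant formula follows by multiplying the
Jacobi–Trudi matrix with the matrix that expresses powers of `x_k` by complete homogeneous
polynomials. Finally, every symmetric polynomial has a unique Schur expansion since an alternating
polynomial is determined by its coefficients at strictly decreasing exponents, and plethysms are
symmetric since the multiset of weights of tableaux is invariant under permuting the letters.
-/

/-! ### Branching of determinants -/

theorem det_sum_rows_eq_sum_det {m : ℕ} {R : Type*} [CommRing R] (s : Fin m → Finset ℕ)
    (a : Fin m → ℕ → R) (r : ℕ → Fin m → R) :
    Matrix.det (Matrix.of fun i => ∑ b ∈ s i, a i b • r b) =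
      ∑ β ∈ Fintype.piFinset s, (∏ i, a i (β i)) * Matrix.det (Matrix.of fun i => r (β i)) := by
  have h := (Matrix.detRowAlternating (R := R) (n := Fin m)).toMultilinearMap.map_sum_finset
    (fun i b => a i b • r b) s
  refine h.trans (Finset.sum_congr rfl fun β _ => ?_)
  exact (Matrix.detRowAlternating (R := R) (n := Fin m)).toMultilinearMap.map_smul_univ
    (fun i => a i (β i)) (fun i => r (β i))

/-- The least admissible `i`-th entry of a sequence interlacing the strictly decreasing sequence
`L`: one more than the next entry of `L`, or zero in the last position. -/
def interlaceLower {m : ℕ} (L : Fin m → ℕ) (i : Fin m) : ℕ :=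
  if h : (i : ℕ) + 1 < m then L ⟨i + 1, h⟩ + 1 else 0

/-- The sequences `β` interlacing the strictly decreasing sequence `L`, that is, with
`L (i + 1) < β i ≤ L i` for all `i` (where the last entry is only bounded above). -/
def interlacing {m : ℕ} (L : Fin m → ℕ) : Finset (Fin m → ℕ) :=
  Fintype.piFinset fun i => Finset.Ico (interlaceLower L i) (L i + 1)

theorem det_truncated_rows {m : ℕ} {R : Type*} [CommRing R] (L : Fin m → ℕ) (hL : StrictAnti L)
    (a : R) (r : ℕ → Fin m → R) :
    Matrix.det (Matrix.of fun i => ∑ b ∈ Finset.range (L i + 1), a ^ (L i - b) • r b) =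
      Matrix.det (Matrix.of fun i =>
        ∑ b ∈ Finset.Ico (interlaceLower L i) (L i + 1), a ^ (L i - b) • r b) := by
  cases m with
  | zero => simp
  | succ m =>
    -- Reversing rows and columns puts the row that is left unchanged on top.
    rw [← Matrix.det_submatrix_equiv_self Fin.revPerm, ← Matrix.det_submatrix_equiv_self Fin.revPerm
      (Matrix.of fun i => ∑ b ∈ Finset.Ico (interlaceLower L i) (L i + 1), a ^ (L i - b) • r b)]
    refine Matrix.det_eq_of_forall_row_eq_smul_add_pred
      (fun i => a ^ (L (Fin.rev i.succ) - L (Fin.rev i.castSucc))) ?_ ?_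
    · intro j
      have h0 : interlaceLower L (Fin.last m) = 0 := by
        unfold interlaceLower
        simp
      simp [h0]
    · intro i j
      have hlt : L (Fin.rev i.castSucc) < L (Fin.rev i.succ) :=
        hL (Fin.rev_lt_rev.2 (Fin.castSucc_lt_succ))
      have h0 : interlaceLower L (Fin.rev i.succ) = L (Fin.rev i.castSucc) + 1 := by
        have h1 : ((Fin.rev i.succ : Fin (m + 1)) : ℕ) + 1 < m + 1 := by
          have := i.2
          simp only [Fin.val_rev, Fin.val_succ]
          omega
        have h2 : (⟨(Fin.rev i.succ : Fin (m + 1)) + 1, h1⟩ : Fin (m + 1)) =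
            Fin.rev i.castSucc := by
          have := i.2
          ext
          simp only [Fin.val_rev, Fin.val_succ, Fin.val_castSucc]
          omega
        unfold interlaceLower
        rw [dif_pos h1, h2]
      simp only [Matrix.submatrix_apply, Matrix.of_apply, Fin.revPerm_apply, Finset.sum_apply,
        Pi.smul_apply, smul_eq_mul, h0]
      rw [Finset.range_eq_Ico, Finset.range_eq_Ico,
        ← Finset.sum_Ico_consecutive _ (Nat.zero_le (L (Fin.rev i.castSucc) + 1))
          (by omega : L (Fin.rev i.castSucc) + 1 ≤ L (Fin.rev i.succ) + 1), add_comm,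
        Finset.mul_sum]
      congr 1
      refine Finset.sum_congr rfl fun b hb => ?_
      rw [← mul_assoc, ← pow_add]
      congr 2
      have := Finset.mem_Ico.1 hb
      omega

/-- The determinantal form of the branching rule. It holds because subtracting from each row a
multiple of the next one leaves only the terms between two consecutive bounds. -/
theorem det_branching {m : ℕ} {R : Type*} [CommRing R] (L : Fin m → ℕ) (hL : StrictAnti L)
    (a : R) (r : ℕ → Fin m → R) :
    Matrix.det (Matrix.of fun i => ∑ b ∈ Finset.range (L i + 1), a ^ (L i - b) • r b) =
      ∑ β ∈ interlacing L, (∏ i, a ^ (L i - β i)) * Matrix.det (Matrix.of fun i => r (β i)) := by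
  rw [det_truncated_rows L hL a r]
  exact det_sum_rows_eq_sum_det _ (fun i b => a ^ (L i - b)) r

/-! ### Young diagrams and strictly decreasing sequences -/

/-- The sequence `λ_i + (m - 1 - i)`, `0 ≤ i < m`, of shifted parts of a partition. -/
def shiftedParts (lam : YoungDiagram) (m : ℕ) (i : Fin m) : ℕ := lam.rowLen i + (Fin.rev i : ℕ)

theorem shiftedParts_strictAnti (lam : YoungDiagram) (m : ℕ) : StrictAnti (shiftedParts lam m) := by
  intro i j hij
  have h1 := lam.rowLen_anti i j hij.le
  have h2 : (Fin.rev j : ℕ) < Fin.rev i := Fin.rev_lt_rev.2 hij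
  unfold shiftedParts
  omega

theorem YoungDiagram.rowLen_eq_zero_of_le {lam : YoungDiagram} {m i : ℕ} (h : lam.colLen 0 ≤ m)
    (hi : m ≤ i) : lam.rowLen i = 0 := by
  by_contra h0
  have h1 : (i, 0) ∈ lam := YoungDiagram.mem_iff_lt_rowLen.2 (Nat.pos_of_ne_zero h0)
  have := YoungDiagram.mem_iff_lt_colLen.1 h1
  omega

theorem YoungDiagram.eq_of_rowLen_eq {lam nu : YoungDiagram} (h : ∀ i, lam.rowLen i = nu.rowLen i) :
    lam = nu := by
  ext ⟨i, j⟩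
  rw [YoungDiagram.mem_cells, YoungDiagram.mem_cells, YoungDiagram.mem_iff_lt_rowLen,
    YoungDiagram.mem_iff_lt_rowLen, h]

theorem YoungDiagram.fst_lt_of_mem {lam : YoungDiagram} {m : ℕ} (h : lam.colLen 0 ≤ m)
    {c : ℕ × ℕ} (hc : c ∈ lam) : c.1 < m :=
  lt_of_lt_of_le (YoungDiagram.mem_iff_lt_colLen.1 hc)
    ((lam.colLen_anti 0 c.2 (Nat.zero_le _)).trans h)

theorem YoungDiagram.colLen_zero_le {lam : YoungDiagram} {m : ℕ} (h : ∀ c ∈ lam, c.1 < m) :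
    lam.colLen 0 ≤ m := by
  by_contra h0
  exact lt_irrefl _ (h (m, 0) (YoungDiagram.mem_iff_lt_colLen.2 (not_le.1 h0)))

theorem YoungDiagram.card_eq_sum_rowLen {lam : YoungDiagram} {m : ℕ} (h : lam.colLen 0 ≤ m) :
    lam.card = ∑ i : Fin m, lam.rowLen i := by
  rw [Fin.sum_univ_eq_sum_range (fun i => lam.rowLen i) m]
  have := Finset.card_eq_sum_card_fiberwise (s := lam.cells) (t := Finset.range m) (f := Prod.fst)
    (fun c hc => Finset.mem_coe.2 (Finset.mem_range.2
      (YoungDiagram.fst_lt_of_mem h ((YoungDiagram.mem_cells _).1 (Finset.mem_coe.1 hc)))))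
  refine this.trans (Finset.sum_congr rfl fun i _ => ?_)
  rw [YoungDiagram.rowLen_eq_card]
  rfl

theorem shiftedParts_injective {lam nu : YoungDiagram} {m : ℕ} (hl : lam.colLen 0 ≤ m)
    (hn : nu.colLen 0 ≤ m) (h : shiftedParts lam m = shiftedParts nu m) : lam = nu := by
  refine YoungDiagram.eq_of_rowLen_eq fun i => ?_
  by_cases hi : i < m
  · have := congrFun h ⟨i, hi⟩
    simpa [shiftedParts] using this
  · rw [YoungDiagram.rowLen_eq_zero_of_le hl (not_lt.1 hi),
      YoungDiagram.rowLen_eq_zero_of_le hn (not_lt.1 hi)]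

theorem rev_add_le_of_strictAnti {m : ℕ} {L : Fin m → ℕ} (hL : StrictAnti L) {i j : Fin m}
    (hij : i ≤ j) : L j + (Fin.rev i : ℕ) ≤ L i + (Fin.rev j : ℕ) := by
  obtain ⟨d, hd⟩ : ∃ d, (j : ℕ) = i + d := ⟨j - i, by have : (i : ℕ) ≤ j := hij; omega⟩
  induction d generalizing j with
  | zero =>
    have : i = j := Fin.ext (by omega)
    rw [this]
  | succ d ih =>
    have hj := j.2
    have h1 := ih (j := ⟨i + d, by omega⟩) (Fin.le_def.2 (by simp)) rfl
    have h2 := hL (show (⟨i + d, by omega⟩ : Fin m) < j from Fin.lt_def.2 (by simp; omega))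
    simp only [Fin.val_rev] at h1 ⊢
    omega

/-- Every strictly decreasing sequence of length `m` consists of the shifted parts of a partition
with at most `m` parts. -/
theorem exists_shiftedParts_eq {m : ℕ} {L : Fin m → ℕ} (hL : StrictAnti L) :
    ∃ lam : YoungDiagram, lam.colLen 0 ≤ m ∧ shiftedParts lam m = L := by
  have hrev : ∀ i, (Fin.rev i : ℕ) ≤ L i := by
    intro i
    have hm : 0 < m := i.pos
    have := rev_add_le_of_strictAnti hL (i := i) (j := ⟨m - 1, by omega⟩)
      (Fin.le_def.2 (by have := i.2; simp; omega))
    simp only [Fin.val_rev] at this ⊢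
    omega
  have hanti : Antitone fun i => L i - (Fin.rev i : ℕ) := by
    intro i j hij
    have := rev_add_le_of_strictAnti hL hij
    have := hrev i
    have := hrev j
    show L j - (Fin.rev j : ℕ) ≤ L i - (Fin.rev i : ℕ)
    omega
  have hsorted : (List.ofFn fun i => L i - (Fin.rev i : ℕ)).SortedGE := by
    exact hanti.sortedGE_ofFn
  refine ⟨YoungDiagram.ofRowLens _ hsorted, ?_, ?_⟩
  · refine YoungDiagram.colLen_zero_le fun c hc => ?_
    obtain ⟨h, -⟩ := YoungDiagram.mem_ofRowLens.1 hc
    simpa using h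
  · funext i
    have := YoungDiagram.rowLen_ofRowLens (hw := hsorted) ⟨i, by simp⟩
    have h2 := hrev i
    simp only [Fin.getElem_fin, List.getElem_ofFn, Fin.eta] at this
    unfold shiftedParts
    omega

/-! ### Branching of semistandard tableaux -/

/-- The cells of a tableau whose entries are smaller than `N`. -/
def innerShape {nu : YoungDiagram} (T : SemistandardYoungTableau nu) (N : ℕ) : YoungDiagram where
  cells := nu.cells.filter fun c => T c.1 c.2 < N
  isLowerSet := by
    intro c d hdc hc
    simp only [Finset.coe_filter, Set.mem_ofPred_eq, YoungDiagram.mem_cells] at hc ⊢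
    refine ⟨nu.isLowerSet hdc hc.1, lt_of_le_of_lt ?_ hc.2⟩
    exact (T.col_weak hdc.1 (nu.up_left_mem le_rfl hdc.2 hc.1)).trans
      (T.row_weak_of_le hdc.2 hc.1)

theorem mem_innerShape {nu : YoungDiagram} {T : SemistandardYoungTableau nu} {N i j : ℕ} :
    (i, j) ∈ innerShape T N ↔ (i, j) ∈ nu ∧ T i j < N := by
  rw [← YoungDiagram.mem_cells]
  simp [innerShape]

/-- The part of a tableau with entries smaller than `N`. -/
def innerTableau {nu kap : YoungDiagram} {N : ℕ} (T : BoundedSSYT nu (N + 1))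
    (h : innerShape T.1 N = kap) : BoundedSSYT kap N where
  val :=
    { entry := fun i j => if (i, j) ∈ kap then T.1 i j else 0
      row_weak' := by
        intro i j1 j2 hj hc
        rw [if_pos hc, if_pos (kap.up_left_mem le_rfl hj.le hc)]
        rw [← h, mem_innerShape] at hc
        exact T.1.row_weak hj hc.1
      col_strict' := by
        intro i1 i2 j hi hc
        rw [if_pos hc, if_pos (kap.up_left_mem hi.le le_rfl hc)]
        rw [← h, mem_innerShape] at hc
        exact T.1.col_strict hi hc.1
      zeros' := fun hc => if_neg hc }
  property := by
    intro i j hc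
    have : (if (i, j) ∈ kap then T.1 i j else 0) < N := by
      rw [if_pos hc]
      rw [← h, mem_innerShape] at hc
      exact hc.2
    exact this

theorem innerTableau_apply {nu kap : YoungDiagram} {N : ℕ} (T : BoundedSSYT nu (N + 1))
    (h : innerShape T.1 N = kap) (i j : ℕ) :
    (innerTableau T h).1 i j = if (i, j) ∈ kap then T.1 i j else 0 := rfl

/-- A tableau on the letters below `N` is extended to a larger shape by filling the new cells, which
must lie in different columns, with the letter `N`. -/
def outerTableau {nu kap : YoungDiagram} {N : ℕ} (hle : kap ≤ nu)
    (hstrip : ∀ i j, (i + 1, j) ∈ nu → (i, j) ∈ kap) (T : BoundedSSYT kap N) :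
    BoundedSSYT nu (N + 1) where
  val :=
    { entry := fun i j => if (i, j) ∈ kap then T.1 i j else if (i, j) ∈ nu then N else 0
      row_weak' := by
        intro i j1 j2 hj hc
        by_cases h2 : (i, j2) ∈ kap
        · rw [if_pos h2, if_pos (kap.up_left_mem le_rfl hj.le h2)]
          exact T.1.row_weak hj h2
        · rw [if_neg h2, if_pos hc]
          split_ifs with h1 h3
          · exact (T.2 _ _ h1).le
          · exact le_rfl
          · exact Nat.zero_le _
      col_strict' := by
        intro i1 i2 j hi hc
        have h1 : (i1, j) ∈ kap := by
          obtain ⟨k, rfl⟩ : ∃ k, i2 = k + 1 := ⟨i2 - 1, by omega⟩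
          exact kap.up_left_mem (by omega) le_rfl (hstrip _ _ hc)
        by_cases h2 : (i2, j) ∈ kap
        · rw [if_pos h1, if_pos h2]
          exact T.1.col_strict hi h2
        · rw [if_pos h1, if_neg h2, if_pos hc]
          exact T.2 _ _ h1
      zeros' := by
        intro i j hc
        rw [if_neg fun h => hc (hle h), if_neg hc] }
  property := by
    intro i j hc
    show (if (i, j) ∈ kap then T.1 i j else if (i, j) ∈ nu then N else 0) < N + 1
    split_ifs with h
    · exact (T.2 _ _ h).trans (Nat.lt_succ_self _)
    · exact Nat.lt_succ_self _

theorem outerTableau_apply {nu kap : YoungDiagram} {N : ℕ} (hle : kap ≤ nu)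
    (hstrip : ∀ i j, (i + 1, j) ∈ nu → (i, j) ∈ kap) (T : BoundedSSYT kap N) (i j : ℕ) :
    (outerTableau hle hstrip T).1 i j =
      if (i, j) ∈ kap then T.1 i j else if (i, j) ∈ nu then N else 0 := rfl

theorem innerShape_outerTableau {nu kap : YoungDiagram} {N : ℕ} (hle : kap ≤ nu)
    (hstrip : ∀ i j, (i + 1, j) ∈ nu → (i, j) ∈ kap) (T : BoundedSSYT kap N) :
    innerShape (outerTableau hle hstrip T).1 N = kap := by
  ext ⟨i, j⟩
  rw [YoungDiagram.mem_cells, YoungDiagram.mem_cells, mem_innerShape, outerTableau_apply]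
  by_cases h : (i, j) ∈ kap
  · simp [h, hle h, T.2 _ _ h]
  · by_cases h' : (i, j) ∈ nu <;> simp [h, h']

theorem innerShape_le {nu : YoungDiagram} (T : SemistandardYoungTableau nu) (N : ℕ) :
    innerShape T N ≤ nu := by
  rintro ⟨i, j⟩ h
  exact (mem_innerShape.1 h).1

theorem mem_innerShape_of_succ_mem {nu : YoungDiagram} {N : ℕ} (T : BoundedSSYT nu (N + 1))
    {i j : ℕ} (h : (i + 1, j) ∈ nu) : (i, j) ∈ innerShape T.1 N := by
  refine mem_innerShape.2 ⟨nu.up_left_mem (Nat.le_succ i) le_rfl h, ?_⟩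
  have h1 : T.1 i j < T.1 (i + 1) j := T.1.col_strict (Nat.lt_succ_self i) h
  have h2 := T.2 _ _ h
  omega

/-- The product of `z_{T(c)}` over all cells `c` of the shape of a tableau `T`. -/
def tableauProd {nu : YoungDiagram} {R : Type*} [CommRing R] (z : ℕ → R)
    (T : SemistandardYoungTableau nu) : R :=
  ∏ c ∈ nu.cells, z (T c.1 c.2)

theorem tableauProd_outerTableau {nu kap : YoungDiagram} {N : ℕ} (hle : kap ≤ nu)
    (hstrip : ∀ i j, (i + 1, j) ∈ nu → (i, j) ∈ kap) (T : BoundedSSYT kap N) {R : Type*}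
    [CommRing R] (z : ℕ → R) :
    tableauProd z (outerTableau hle hstrip T).1 =
      z N ^ (nu.card - kap.card) * tableauProd z T.1 := by
  have hsub : kap.cells ⊆ nu.cells := YoungDiagram.cells_subset_iff.2 hle
  unfold tableauProd
  rw [← Finset.prod_sdiff hsub]
  congr 1
  · rw [Finset.prod_congr rfl (g := fun _ => z N), Finset.prod_const,
      Finset.card_sdiff_of_subset hsub]
    rintro ⟨i, j⟩ h
    simp only [Finset.mem_sdiff, YoungDiagram.mem_cells] at h
    simp [outerTableau_apply, h.1, h.2]
  · refine Finset.prod_congr rfl ?_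
    rintro ⟨i, j⟩ h
    rw [YoungDiagram.mem_cells] at h
    simp [outerTableau_apply, h]

open Classical in
theorem sum_tableauProd_of_innerShape_eq {nu kap : YoungDiagram} {N : ℕ} (hle : kap ≤ nu)
    (hstrip : ∀ i j, (i + 1, j) ∈ nu → (i, j) ∈ kap) {R : Type*} [CommRing R] (z : ℕ → R) :
    ∑ T : BoundedSSYT nu (N + 1) with innerShape T.1 N = kap, tableauProd z T.1 =
      z N ^ (nu.card - kap.card) * ∑ T : BoundedSSYT kap N, tableauProd z T.1 := by
  rw [Finset.mul_sum]
  symm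
  refine Finset.sum_bij' (fun T _ => outerTableau hle hstrip T)
    (fun T hT => innerTableau T (Finset.mem_filter.1 hT).2) ?_ ?_ ?_ ?_ ?_
  · intro T _
    simp [innerShape_outerTableau]
  · intro T _
    exact Finset.mem_univ _
  · intro T _
    apply Subtype.ext
    ext i j
    rw [innerTableau_apply, outerTableau_apply]
    by_cases h : (i, j) ∈ kap
    · simp [h]
    · simp [h, T.1.zeros h]
  · intro T hT
    have hk : innerShape T.1 N = kap := (Finset.mem_filter.1 hT).2
    apply Subtype.ext
    ext i j
    rw [outerTableau_apply, innerTableau_apply]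
    by_cases h : (i, j) ∈ kap
    · simp [h]
    · by_cases h' : (i, j) ∈ nu
      · have h1 := T.2 _ _ h'
        have h2 : ¬ T.1 i j < N := fun h2 => h (hk ▸ mem_innerShape.2 ⟨h', h2⟩)
        simp only [h, h', if_false, if_true]
        omega
      · simp [h, h', T.1.zeros h']
  · intro T _
    rw [tableauProd_outerTableau]

theorem mem_interlacing_iff {m : ℕ} {nu kap : YoungDiagram} (hn : nu.colLen 0 ≤ m)
    (hk : kap.colLen 0 ≤ m) :
    shiftedParts kap m ∈ interlacing (shiftedParts nu m) ↔
      kap ≤ nu ∧ ∀ i j, (i + 1, j) ∈ nu → (i, j) ∈ kap := by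
  have hint : shiftedParts kap m ∈ interlacing (shiftedParts nu m) ↔
      ∀ i : Fin m, kap.rowLen i ≤ nu.rowLen i ∧ nu.rowLen (i + 1) ≤ kap.rowLen i := by
    simp only [interlacing, Fintype.mem_piFinset, Finset.mem_Ico]
    refine forall_congr' fun i => ?_
    have hi := i.2
    by_cases h : (i : ℕ) + 1 < m
    · simp only [interlaceLower, dif_pos h, shiftedParts, Fin.val_rev]
      omega
    · have h0 : nu.rowLen (i + 1) = 0 := YoungDiagram.rowLen_eq_zero_of_le hn (not_lt.1 h)
      simp only [interlaceLower, dif_neg h, shiftedParts, Fin.val_rev]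
      omega
  rw [hint]
  constructor
  · intro h
    constructor
    · rintro ⟨i, j⟩ hc
      have hi : i < m := YoungDiagram.fst_lt_of_mem hk hc
      exact YoungDiagram.mem_iff_lt_rowLen.2
        ((YoungDiagram.mem_iff_lt_rowLen.1 hc).trans_le (h ⟨i, hi⟩).1)
    · intro i j hc
      have hi : i + 1 < m := YoungDiagram.fst_lt_of_mem hn hc
      exact YoungDiagram.mem_iff_lt_rowLen.2
        ((YoungDiagram.mem_iff_lt_rowLen.1 hc).trans_le (h ⟨i, by omega⟩).2)
  · rintro ⟨hle, hstrip⟩ i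
    constructor
    · by_contra hlt
      exact absurd (YoungDiagram.mem_iff_lt_rowLen.1
        (hle (YoungDiagram.mem_iff_lt_rowLen.2 (not_le.1 hlt)))) (lt_irrefl _)
    · by_contra hlt
      exact absurd (YoungDiagram.mem_iff_lt_rowLen.1
        (hstrip _ _ (YoungDiagram.mem_iff_lt_rowLen.2 (not_le.1 hlt)))) (lt_irrefl _)

theorem interlacing_strictAnti {m : ℕ} {L β : Fin m → ℕ} (hL : StrictAnti L)
    (hβ : β ∈ interlacing L) : StrictAnti β := by
  simp only [interlacing, Fintype.mem_piFinset, Finset.mem_Ico] at hβ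
  intro i j hij
  have h1 := (hβ i).1
  have h2 := (hβ j).2
  have hlt : (i : ℕ) + 1 < m := lt_of_le_of_lt (Nat.succ_le_of_lt hij) j.2
  have h3 : L j ≤ L ⟨i + 1, hlt⟩ := hL.antitone (Fin.le_def.2 (Nat.succ_le_of_lt hij))
  rw [interlaceLower, dif_pos hlt] at h1
  omega

/-! ### The Jacobi–Trudi formula -/

/-- The generating series `∑ h_k(z_0, …, z_{N-1}) t^k = ∏ 1 / (1 - z_i t)` of the complete
homogeneous symmetric polynomials, evaluated at `z`. -/
noncomputable def completeSeries {R : Type*} [CommRing R] (z : ℕ → R) (N : ℕ) : PowerSeries R :=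
  ∏ i ∈ Finset.range N, PowerSeries.mk fun k => z i ^ k

theorem coeff_mul_geometric {R : Type*} [CommRing R] (F : PowerSeries R) (a : R) (k : ℕ) :
    PowerSeries.coeff k (F * PowerSeries.mk fun k => a ^ k) =
      ∑ b ∈ Finset.range (k + 1), a ^ (k - b) * PowerSeries.coeff b F := by
  rw [PowerSeries.coeff_mul, Finset.Nat.sum_antidiagonal_eq_sum_range_succ_mk]
  refine Finset.sum_congr rfl fun b _ => ?_
  rw [PowerSeries.coeff_mk, mul_comm]

theorem boundedSSYT_zero_iff (nu : YoungDiagram) : Nonempty (BoundedSSYT nu 0) ↔ nu = ⊥ := by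
  constructor
  · rintro ⟨T⟩
    ext ⟨i, j⟩
    rw [YoungDiagram.mem_cells, YoungDiagram.mem_cells]
    exact ⟨fun h => absurd (T.2 _ _ h) (Nat.not_lt_zero _), fun h => absurd h (by simp)⟩
  · rintro rfl
    exact ⟨⟨SemistandardYoungTableau.highestWeight ⊥, fun i j h => absurd h (by simp)⟩⟩

instance : Subsingleton (SemistandardYoungTableau ⊥) :=
  ⟨fun T T' => by ext i j; rw [T.zeros (by simp), T'.zeros (by simp)]⟩

theorem shiftedParts_bot (m : ℕ) (i : Fin m) : shiftedParts ⊥ m i = (Fin.rev i : ℕ) := by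
  have h : (⊥ : YoungDiagram).rowLen i = 0 := by
    by_contra h0
    exact absurd (YoungDiagram.mem_iff_lt_rowLen.2 (Nat.pos_of_ne_zero h0)) (by simp)
  simp [shiftedParts, h]

theorem eq_id_of_strictMono_fin {m : ℕ} {g : Fin m → Fin m} (hg : StrictMono g) : g = id := by
  have hsurj := Finite.surjective_of_injective hg.injective
  have h : hg.orderIsoOfSurjective g hsurj = OrderIso.refl _ := Subsingleton.elim _ _
  exact congrArg (fun e : Fin m ≃o Fin m => ⇑e) h

theorem det_kronecker_shiftedParts {m : ℕ} {R : Type*} [CommRing R] {L : Fin m → ℕ}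
    (hL : StrictAnti L) (h : L ≠ fun i => (Fin.rev i : ℕ)) :
    Matrix.det (Matrix.of fun i j : Fin m => if L i = (Fin.rev j : ℕ) then (1 : R) else 0) = 0 := by
  -- Some row vanishes: otherwise `L` takes its `m` values below `m`, in decreasing order.
  by_cases hrow : ∃ i, ∀ j : Fin m, L i ≠ (Fin.rev j : ℕ)
  · obtain ⟨i, hi⟩ := hrow
    exact Matrix.det_eq_zero_of_row_eq_zero i fun j => if_neg (hi j)
  · push Not at hrow
    choose g hg using hrow
    have hmono : StrictMono g := by
      intro i j hij
      have := hL hij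
      rw [hg, hg] at this
      exact Fin.rev_lt_rev.1 (Fin.lt_def.2 this)
    exfalso
    apply h
    funext i
    rw [hg i]
    rw [eq_id_of_strictMono_fin hmono, id]

/-- The Jacobi–Trudi formula `s_ν = det (h_{ν_i - i + j})` for the tableau definition of Schur
polynomials, with `m ≥ ℓ(ν)` rows. Both sides satisfy the same branching rule when the last
variable is removed. -/
theorem sum_tableauProd_eq_det {R : Type*} [CommRing R] (z : ℕ → R) (m N : ℕ) (nu : YoungDiagram)
    (hn : nu.colLen 0 ≤ m) :
    ∑ T : BoundedSSYT nu N, tableauProd z T.1 =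
      Matrix.det (Matrix.of fun i j : Fin m =>
        PowerSeries.coeff (shiftedParts nu m i)
          (PowerSeries.X ^ (Fin.rev j : ℕ) * completeSeries z N)) := by
  classical
  induction N generalizing nu with
  | zero =>
    simp only [completeSeries, Finset.range_zero, Finset.prod_empty, mul_one,
      PowerSeries.coeff_X_pow]
    by_cases hb : nu = ⊥
    · subst hb
      obtain ⟨T0⟩ := (boundedSSYT_zero_iff ⊥).2 rfl
      have huniq : ∀ T : BoundedSSYT ⊥ 0, T = T0 := fun T => Subtype.ext (Subsingleton.elim _ _)
      rw [Finset.sum_eq_single T0 (fun T _ h => absurd (huniq T) h) (by simp)]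
      have hone : (Matrix.of fun i j : Fin m =>
          if shiftedParts ⊥ m i = (Fin.rev j : ℕ) then (1 : R) else 0) = 1 := by
        ext i j
        rw [Matrix.of_apply, shiftedParts_bot, Matrix.one_apply]
        simp only [Fin.val_inj, Fin.rev_inj]
      rw [hone, Matrix.det_one]
      simp [tableauProd]
    · have hempty : IsEmpty (BoundedSSYT nu 0) := by
        rw [← not_nonempty_iff, boundedSSYT_zero_iff]
        exact hb
      rw [Finset.univ_eq_empty, Finset.sum_empty, det_kronecker_shiftedParts
        (shiftedParts_strictAnti nu m)]
      intro h
      refine hb (shiftedParts_injective hn (m := m) ?_ (h.trans ?_))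
      · exact YoungDiagram.colLen_zero_le fun c hc => absurd hc (by simp)
      · funext i
        rw [shiftedParts_bot]
  | succ N ih =>
    have hinner : ∀ T : BoundedSSYT nu (N + 1), (innerShape T.1 N).colLen 0 ≤ m := fun T =>
      YoungDiagram.colLen_zero_le fun c hc =>
        YoungDiagram.fst_lt_of_mem hn (innerShape_le T.1 N hc)
    have hmaps : ∀ T : BoundedSSYT nu (N + 1),
        shiftedParts (innerShape T.1 N) m ∈ interlacing (shiftedParts nu m) := fun T =>
      (mem_interlacing_iff hn (hinner T)).2
        ⟨innerShape_le T.1 N, fun i j h => mem_innerShape_of_succ_mem T h⟩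
    have hrows : (Matrix.of fun i j : Fin m => PowerSeries.coeff (shiftedParts nu m i)
          (PowerSeries.X ^ (Fin.rev j : ℕ) * completeSeries z (N + 1))) =
        Matrix.of fun i => ∑ b ∈ Finset.range (shiftedParts nu m i + 1),
          z N ^ (shiftedParts nu m i - b) • fun j : Fin m =>
            PowerSeries.coeff b (PowerSeries.X ^ (Fin.rev j : ℕ) * completeSeries z N) := by
      ext i j
      rw [Matrix.of_apply, Matrix.of_apply, completeSeries, Finset.prod_range_succ, ← mul_assoc,
        coeff_mul_geometric]
      simp [completeSeries]
    rw [hrows, det_branching _ (shiftedParts_strictAnti nu m),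
      ← Finset.sum_fiberwise_of_maps_to (fun T _ => hmaps T)]
    refine Finset.sum_congr rfl fun β hβ => ?_
    obtain ⟨kap, hk, rfl⟩ :=
      exists_shiftedParts_eq (interlacing_strictAnti (shiftedParts_strictAnti nu m) hβ)
    obtain ⟨hle, hstrip⟩ := (mem_interlacing_iff hn hk).1 hβ
    rw [← ih kap hk]
    have hfilter : (Finset.univ.filter fun T : BoundedSSYT nu (N + 1) =>
        shiftedParts (innerShape T.1 N) m = shiftedParts kap m) =
        Finset.univ.filter fun T : BoundedSSYT nu (N + 1) => innerShape T.1 N = kap :=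
      Finset.filter_congr fun T _ =>
        ⟨fun h => shiftedParts_injective (hinner T) hk h, fun h => by rw [h]⟩
    rw [hfilter, sum_tableauProd_of_innerShape_eq hle hstrip, Finset.prod_pow_eq_pow_sum]
    congr 2
    rw [YoungDiagram.card_eq_sum_rowLen hn, YoungDiagram.card_eq_sum_rowLen hk]
    have hrow : ∀ i : Fin m, kap.rowLen i ≤ nu.rowLen i := fun i => by
      by_contra hlt
      exact absurd (YoungDiagram.mem_iff_lt_rowLen.1
        (hle (YoungDiagram.mem_iff_lt_rowLen.2 (not_le.1 hlt)))) (lt_irrefl _)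
    rw [← Finset.sum_tsub_distrib _ fun i _ => hrow i]
    exact Finset.sum_congr rfl fun i _ => by simp only [shiftedParts]; omega

/-- The generating series `∏ 1 / (1 - z_i t)` of the complete homogeneous symmetric functions of a
finite family `z`. -/
noncomputable def completeSeriesOf {ι R : Type*} [Fintype ι] [CommRing R] (z : ι → R) :
    PowerSeries R :=
  ∏ i, PowerSeries.mk fun k => z i ^ k

theorem aeval_schurPoly_eq_sum {R : Type*} [CommRing R] [Algebra ℤ R] {N : ℕ} (z : ℕ → R) (nu : YoungDiagram) :
    MvPolynomial.aeval (fun i : Fin N => z i) (schurPoly nu N) =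
      ∑ T : BoundedSSYT nu N, tableauProd z T.1 := by
  rw [schurPoly, map_sum]
  refine Finset.sum_congr rfl fun T _ => ?_
  rw [BoundedSSYT.weightMonomial, map_prod, tableauProd,
    ← Finset.prod_coe_sort nu.cells fun c => z (T.1 c.1 c.2)]
  exact Finset.prod_congr rfl fun c _ => MvPolynomial.aeval_X (R := ℤ) (fun i : Fin N => z i) _

/-- The Jacobi–Trudi formula for the value of a Schur polynomial at a family `z`. -/
theorem aeval_schurPoly_eq_det {R : Type*} [CommRing R] [Algebra ℤ R]
    {N m : ℕ} (z : Fin N → R)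
    {nu : YoungDiagram} (hn : nu.colLen 0 ≤ m) :
    MvPolynomial.aeval z (schurPoly nu N) =
      Matrix.det (Matrix.of fun i j : Fin m => PowerSeries.coeff (shiftedParts nu m i)
        (PowerSeries.X ^ (Fin.rev j : ℕ) * completeSeriesOf z)) := by
  obtain ⟨y, hy⟩ : ∃ y : ℕ → R, z = fun i : Fin N => y i :=
    ⟨fun k => if h : k < N then z ⟨k, h⟩ else 0, by funext i; simp⟩
  have hs : completeSeriesOf z = completeSeries y N := by
    rw [completeSeriesOf, completeSeries, hy,
      Fin.prod_univ_eq_prod_range (fun i => PowerSeries.mk fun k => y i ^ k) N]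
  rw [hs, hy, aeval_schurPoly_eq_sum, sum_tableauProd_eq_det y m N nu hn]

theorem aeval_schurPoly_congr {R : Type*} [CommRing R] [Algebra ℤ R]
    {N N' : ℕ} {z : Fin N → R} {z' : Fin N' → R}
    (h : completeSeriesOf z = completeSeriesOf z') (nu : YoungDiagram) :
    MvPolynomial.aeval z (schurPoly nu N) = MvPolynomial.aeval z' (schurPoly nu N') := by
  rw [aeval_schurPoly_eq_det z le_rfl, aeval_schurPoly_eq_det z' le_rfl, h]

theorem schurPoly_bot (n : ℕ) : schurPoly ⊥ n = 1 := by
  let T0 : BoundedSSYT ⊥ n :=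
    ⟨SemistandardYoungTableau.highestWeight ⊥, fun i j h => absurd h (by simp)⟩
  rw [schurPoly, Fintype.sum_eq_single T0 fun T h => absurd (Subtype.ext (Subsingleton.elim _ _)) h,
    BoundedSSYT.weightMonomial]
  simp

/-! ### The bialternant formula -/

/-- The alternant `det (x_k ^ L_i)`. -/
noncomputable def alternant {n : ℕ} (L : Fin n → ℕ) : MvPolynomial (Fin n) ℤ :=
  Matrix.det (Matrix.of fun i k : Fin n => (MvPolynomial.X k : MvPolynomial (Fin n) ℤ) ^ L i)

/-- The Vandermonde determinant `∏_{i < j} (x_i - x_j)`, as the alternant of `(n - 1, …, 1, 0)`. -/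
noncomputable def vandermondePoly (n : ℕ) : MvPolynomial (Fin n) ℤ :=
  alternant fun i => (Fin.rev i : ℕ)

theorem geometric_mul_one_sub {R : Type*} [CommRing R] (a : R) :
    (PowerSeries.mk fun k => a ^ k) * (1 - PowerSeries.C a * PowerSeries.X) = 1 := by
  ext k
  cases k with
  | zero => simp [mul_sub, ← mul_assoc]
  | succ k =>
    rw [mul_sub, mul_one, ← mul_assoc, map_sub, PowerSeries.coeff_succ_mul_X,
      PowerSeries.coeff_mul_C, PowerSeries.coeff_mk, PowerSeries.coeff_mk, pow_succ, sub_self]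
    simp [PowerSeries.coeff_one]

/-- The powers of `x_k` are linear combinations of complete homogeneous symmetric polynomials, with
coefficients that do not depend on the exponent: `∏_{i ≠ k} (1 - x_i t)`, a polynomial of degree
less than `n`, times the generating series `∏_i 1 / (1 - x_i t)` is `1 / (1 - x_k t)`. -/
theorem exists_pow_eq_sum_completeSeriesOf {R : Type*} [CommRing R] {n : ℕ} (x : Fin n → R) :
    ∃ M : Matrix (Fin n) (Fin n) R, ∀ (l : ℕ) (k : Fin n), x k ^ l =
      ∑ j, PowerSeries.coeff l (PowerSeries.X ^ (Fin.rev j : ℕ) * completeSeriesOf x) * M j k := by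
  classical
  let E : Fin n → Polynomial R := fun k =>
    ∏ i ∈ Finset.univ.erase k, (1 - Polynomial.C (x i) * Polynomial.X)
  refine ⟨fun j k => (E k).coeff (Fin.rev j), fun l k => ?_⟩
  have hdeg : (E k).natDegree < n := by
    refine lt_of_le_of_lt (Polynomial.natDegree_prod_le _ _) ?_
    refine lt_of_le_of_lt (Finset.sum_le_card_nsmul _ _ 1 fun i _ => ?_) ?_
    · compute_degree
    · have := k.pos
      simp [Finset.card_erase_of_mem]
      omega
  have hE : completeSeriesOf x * (E k : PowerSeries R) = PowerSeries.mk fun j => x k ^ j := by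
    have hcoe : (E k : PowerSeries R) =
        ∏ i ∈ Finset.univ.erase k, (1 - PowerSeries.C (x i) * PowerSeries.X) := by
      rw [← Polynomial.coeToPowerSeries.ringHom_apply, map_prod]
      simp
    rw [completeSeriesOf, ← Finset.mul_prod_erase _ _ (Finset.mem_univ k), hcoe, mul_assoc,
      ← Finset.prod_mul_distrib, Finset.prod_congr rfl fun i _ => geometric_mul_one_sub (x i)]
    simp
  have hsum : (E k : PowerSeries R) =
      ∑ j : Fin n, PowerSeries.C ((E k).coeff (Fin.rev j)) * PowerSeries.X ^ (Fin.rev j : ℕ) := by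
    refine Eq.trans ?_ (Equiv.sum_comp Fin.revPerm (fun j : Fin n =>
      PowerSeries.C ((E k).coeff j) * (PowerSeries.X : PowerSeries R) ^ (j : ℕ))).symm
    rw [Fin.sum_univ_eq_sum_range
      (fun j => PowerSeries.C ((E k).coeff j) * (PowerSeries.X : PowerSeries R) ^ j) n]
    conv_lhs => rw [(E k).as_sum_range_C_mul_X_pow' hdeg]
    rw [← Polynomial.coeToPowerSeries.ringHom_apply, map_sum]
    simp
  have h : x k ^ l = PowerSeries.coeff l (completeSeriesOf x * (E k : PowerSeries R)) := by
    rw [hE, PowerSeries.coeff_mk]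
  rw [h, hsum, Finset.mul_sum, map_sum]
  refine Finset.sum_congr rfl fun j _ => ?_
  rw [show completeSeriesOf x * (PowerSeries.C ((E k).coeff (Fin.rev j)) *
    PowerSeries.X ^ (Fin.rev j : ℕ)) = (PowerSeries.X ^ (Fin.rev j : ℕ) * completeSeriesOf x) *
    PowerSeries.C ((E k).coeff (Fin.rev j)) by ring, PowerSeries.coeff_mul_C]

/-- The bialternant formula `s_λ = a_{λ+ρ} / a_ρ`. -/
theorem schurPoly_mul_vandermondePoly {n : ℕ} {lam : YoungDiagram} (h : lam.colLen 0 ≤ n) :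
    schurPoly lam n * vandermondePoly n = alternant (shiftedParts lam n) := by
  obtain ⟨M, hM⟩ := exists_pow_eq_sum_completeSeriesOf
    (fun k : Fin n => (MvPolynomial.X k : MvPolynomial (Fin n) ℤ))
  have key : ∀ nu : YoungDiagram, nu.colLen 0 ≤ n →
      alternant (shiftedParts nu n) = schurPoly nu n * M.det := by
    intro nu hnu
    have h1 := (MvPolynomial.aeval_X_left_apply (schurPoly nu n)).symm.trans
      (aeval_schurPoly_eq_det MvPolynomial.X hnu)
    rw [h1, ← Matrix.det_mul, alternant]
    exact congrArg Matrix.det (Matrix.ext fun i k => hM _ _)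
  have hbot : vandermondePoly n = M.det := by
    have h1 := key ⊥ (YoungDiagram.colLen_zero_le fun c hc => absurd hc (by simp))
    rw [schurPoly_bot, one_mul] at h1
    rw [← h1, vandermondePoly]
    congr 1
    funext i
    rw [shiftedParts_bot]
  rw [hbot, key lam h]

/-! ### Schur expansions of symmetric polynomials -/

theorem alternant_eq_sum {n : ℕ} (L : Fin n → ℕ) :
    alternant L = ∑ σ : Equiv.Perm (Fin n), Equiv.Perm.sign σ •
      MvPolynomial.monomial (Finsupp.equivFunOnFinite.symm fun k => L (σ k)) (1 : ℤ) := by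
  rw [alternant, Matrix.det_apply]
  refine Finset.sum_congr rfl fun σ _ => ?_
  congr 1
  rw [MvPolynomial.monomial_eq, Finsupp.prod_fintype _ _ fun i => pow_zero _]
  simp

theorem coeff_alternant {n : ℕ} {L : Fin n → ℕ} (hL : StrictAnti L) {d : Fin n →₀ ℕ}
    (hd : StrictAnti d) :
    MvPolynomial.coeff d (alternant L) = if ⇑d = L then 1 else 0 := by
  have hone : ∀ σ : Equiv.Perm (Fin n), (Finsupp.equivFunOnFinite.symm fun k => L (σ k)) = d →
      σ = 1 := by
    intro σ hσ
    have hmono : StrictMono σ := by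
      intro i j hij
      have := hd hij
      rw [← hσ] at this
      exact hL.lt_iff_gt.1 this
    ext1 i
    rw [eq_id_of_strictMono_fin hmono]
    rfl
  rw [alternant_eq_sum, MvPolynomial.coeff_sum, Finset.sum_eq_single 1]
  · rw [Equiv.Perm.sign_one, one_smul, MvPolynomial.coeff_monomial]
    refine if_congr ⟨fun h => by rw [← h]; rfl, fun h => ?_⟩ rfl rfl
    ext i
    rw [h]
    rfl
  · intro σ _ hσ
    rw [Units.smul_def, MvPolynomial.coeff_smul, MvPolynomial.coeff_monomial,
      if_neg fun h => hσ (hone σ h), smul_zero]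
  · simp

theorem vandermondePoly_ne_zero (n : ℕ) : vandermondePoly n ≠ 0 := by
  have hanti : StrictAnti fun i : Fin n => (Fin.rev i : ℕ) := fun i j hij => Fin.rev_lt_rev.2 hij
  intro h
  have h1 := coeff_alternant (d := Finsupp.equivFunOnFinite.symm fun i : Fin n => (Fin.rev i : ℕ))
    hanti hanti
  rw [← vandermondePoly, h, if_pos (show ⇑(Finsupp.equivFunOnFinite.symm
    fun i : Fin n => (Fin.rev i : ℕ)) = fun i => (Fin.rev i : ℕ) from rfl),
    MvPolynomial.coeff_zero] at h1
  exact zero_ne_one h1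

/-- Alternating polynomials: permuting the variables multiplies by the sign of the permutation. -/
def IsAlternating {n : ℕ} (f : MvPolynomial (Fin n) ℤ) : Prop :=
  ∀ σ : Equiv.Perm (Fin n), MvPolynomial.rename σ f = (Equiv.Perm.sign σ : ℤ) • f

theorem isAlternating_alternant {n : ℕ} (L : Fin n → ℕ) : IsAlternating (alternant L) := by
  intro σ
  have h := Matrix.det_permute' σ
    (Matrix.of fun i k : Fin n => (MvPolynomial.X k : MvPolynomial (Fin n) ℤ) ^ L i)
  rw [alternant, AlgHom.map_det, zsmul_eq_mul, ← h]
  congr 1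
  ext1 i k
  simp

/-- An alternating polynomial is determined by its coefficients at strictly decreasing exponents. -/
theorem IsAlternating.eq_zero {n : ℕ} {f : MvPolynomial (Fin n) ℤ} (hf : IsAlternating f)
    (h : ∀ d : Fin n →₀ ℕ, StrictAnti d → MvPolynomial.coeff d f = 0) : f = 0 := by
  have hcoeff : ∀ (σ : Equiv.Perm (Fin n)) (d : Fin n →₀ ℕ), MvPolynomial.coeff d f =
      (Equiv.Perm.sign σ : ℤ) * MvPolynomial.coeff (d.mapDomain σ) f := by
    intro σ d
    rw [← MvPolynomial.coeff_rename_mapDomain σ σ.injective, hf σ, MvPolynomial.coeff_smul,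
      smul_eq_mul]
  ext d
  rw [MvPolynomial.coeff_zero]
  by_cases hd : Function.Injective d
  · -- Sort the exponents into decreasing order.
    let τ : Equiv.Perm (Fin n) := Tuple.sort d
    have hmono : StrictMono (d ∘ τ) :=
      (Tuple.monotone_sort d).strictMono_of_injective (hd.comp τ.injective)
    have hanti : StrictAnti (d.mapDomain ((Fin.revPerm.trans τ).symm)) := by
      intro i j hij
      simp only [Finsupp.mapDomain_equiv_apply, Equiv.symm_symm, Equiv.trans_apply,
        Fin.revPerm_apply]
      exact hmono (Fin.rev_lt_rev.2 hij)
    rw [hcoeff, h _ hanti, mul_zero]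
  · -- A transposition of two equal exponents changes the sign of the coefficient.
    rw [Function.not_injective_iff] at hd
    obtain ⟨i, j, hij, hne⟩ := hd
    have hswap : d.mapDomain (Equiv.swap i j) = d := by
      ext k
      rw [Finsupp.mapDomain_equiv_apply, Equiv.symm_swap]
      rcases eq_or_ne k i with rfl | hki
      · rw [Equiv.swap_apply_left, hij]
      rcases eq_or_ne k j with rfl | hkj
      · rw [Equiv.swap_apply_right, hij]
      · rw [Equiv.swap_apply_of_ne_of_ne hki hkj]
    have h1 := hcoeff (Equiv.swap i j) d
    rw [hswap, Equiv.Perm.sign_swap hne] at h1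
    push_cast at h1
    omega

/-- The exponent `λ + ρ` of a partition `λ` with at most `n` parts, where
`ρ = (n - 1, …, 1, 0)`. -/
noncomputable def shiftedExponent {n : ℕ} (lam : PartitionLE n) : Fin n →₀ ℕ :=
  Finsupp.equivFunOnFinite.symm (shiftedParts lam.1 n)

theorem shiftedExponent_injective (n : ℕ) :
    Function.Injective (shiftedExponent : PartitionLE n → Fin n →₀ ℕ) := fun lam nu h =>
  Subtype.ext (shiftedParts_injective lam.2 nu.2 (Finsupp.equivFunOnFinite.symm.injective h))

theorem shiftedExponent_strictAnti {n : ℕ} (lam : PartitionLE n) :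
    StrictAnti (shiftedExponent lam) :=
  shiftedParts_strictAnti lam.1 n

theorem exists_shiftedExponent_eq {n : ℕ} {d : Fin n →₀ ℕ} (hd : StrictAnti d) :
    ∃ lam : PartitionLE n, shiftedExponent lam = d := by
  obtain ⟨lam, hlam, h⟩ := exists_shiftedParts_eq hd
  refine ⟨⟨lam, hlam⟩, ?_⟩
  ext i
  exact congrFun h i

theorem coeff_vandermondePoly_mul_sum {n : ℕ} (c : PartitionLE n →₀ ℤ) (lam : PartitionLE n) :
    MvPolynomial.coeff (shiftedExponent lam)
      (vandermondePoly n * c.sum fun nu a => a • schurPoly nu.1 n) = c lam := by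
  rw [Finsupp.mul_sum, Finsupp.sum, MvPolynomial.coeff_sum, Finset.sum_eq_single lam]
  · rw [mul_smul_comm, mul_comm, schurPoly_mul_vandermondePoly lam.2, MvPolynomial.coeff_smul,
      coeff_alternant (shiftedParts_strictAnti lam.1 n) (shiftedExponent_strictAnti lam),
      if_pos (show ⇑(shiftedExponent lam) = shiftedParts lam.1 n from rfl), smul_eq_mul, mul_one]
  · intro nu _ hne
    rw [mul_smul_comm, mul_comm, schurPoly_mul_vandermondePoly nu.2, MvPolynomial.coeff_smul,
      coeff_alternant (shiftedParts_strictAnti nu.1 n) (shiftedExponent_strictAnti lam), if_neg,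
      smul_zero]
    intro h
    exact hne (shiftedExponent_injective n (Finsupp.ext fun i => (congrFun h i).symm))
  · intro h
    rw [Finsupp.notMem_support_iff.1 h, zero_smul, mul_zero, MvPolynomial.coeff_zero]

/-- The coefficients of a Schur expansion of `f` can be read off from `a_ρ f`. -/
theorem IsSchurExpansion.apply_eq {n : ℕ} {f : MvPolynomial (Fin n) ℤ} {c : PartitionLE n →₀ ℤ}
    (h : IsSchurExpansion f c) (lam : PartitionLE n) :
    c lam = MvPolynomial.coeff (shiftedExponent lam) (vandermondePoly n * f) := by
  rw [IsSchurExpansion] at h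
  rw [h, coeff_vandermondePoly_mul_sum]

theorem isAlternating_vandermondePoly_mul {n : ℕ} {f : MvPolynomial (Fin n) ℤ}
    (hf : f.IsSymmetric) : IsAlternating (vandermondePoly n * f) := by
  intro σ
  rw [map_mul, hf σ, vandermondePoly, isAlternating_alternant _ σ, smul_mul_assoc]

theorem isSymmetric_schurPoly (nu : YoungDiagram) (n : ℕ) : (schurPoly nu n).IsSymmetric := by
  intro σ
  have h : MvPolynomial.rename σ (schurPoly nu n) = MvPolynomial.aeval
      (fun k : Fin n => (MvPolynomial.X (σ k) : MvPolynomial (Fin n) ℤ)) (schurPoly nu n) := by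
    conv_lhs => rw [← MvPolynomial.aeval_X_left_apply (schurPoly nu n)]
    rw [MvPolynomial.comp_aeval_apply]
    simp
  conv_rhs => rw [← MvPolynomial.aeval_X_left_apply (schurPoly nu n)]
  rw [h]
  exact aeval_schurPoly_congr (Equiv.prod_comp σ fun k => PowerSeries.mk fun l =>
    (MvPolynomial.X k : MvPolynomial (Fin n) ℤ) ^ l) nu

theorem exists_isSchurExpansion {n : ℕ} {f : MvPolynomial (Fin n) ℤ} (hf : f.IsSymmetric) :
    ∃ c, IsSchurExpansion f c := by
  let c : PartitionLE n →₀ ℤ := Finsupp.ofSupportFinite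
    (fun lam => MvPolynomial.coeff (shiftedExponent lam) (vandermondePoly n * f))
    (((vandermondePoly n * f).support.finite_toSet.preimage
      (shiftedExponent_injective n).injOn).subset fun lam h =>
        MvPolynomial.mem_support_iff.2 h)
  have hsym : (c.sum fun nu a => a • schurPoly nu.1 n).IsSymmetric := by
    intro σ
    rw [Finsupp.sum, map_sum]
    exact Finset.sum_congr rfl fun nu _ => by rw [map_zsmul, isSymmetric_schurPoly nu.1 n σ]
  refine ⟨c, ?_⟩
  have hzero : vandermondePoly n * (f - c.sum fun nu a => a • schurPoly nu.1 n) = 0 := by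
    refine (isAlternating_vandermondePoly_mul (hf.sub hsym)).eq_zero fun d hd => ?_
    obtain ⟨lam, rfl⟩ := exists_shiftedExponent_eq hd
    rw [mul_sub, MvPolynomial.coeff_sub, coeff_vandermondePoly_mul_sum]
    exact sub_self _
  exact sub_eq_zero.1 ((mul_eq_zero.1 hzero).resolve_left (vandermondePoly_ne_zero n))

/-! ### Symmetry of plethysms -/

/-- The exponent of the monomial `x^{wt(T)}`. -/
noncomputable def BoundedSSYT.weight {lam : YoungDiagram} {n : ℕ} (T : BoundedSSYT lam n) :
    Fin n →₀ ℕ :=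
  ∑ c : lam.cells,
    Finsupp.single ⟨T.1 c.1.1 c.1.2, T.2 _ _ ((YoungDiagram.mem_cells _).1 c.2)⟩ 1

theorem BoundedSSYT.weightMonomial_eq {lam : YoungDiagram} {n : ℕ} (T : BoundedSSYT lam n) :
    T.weightMonomial = MvPolynomial.monomial T.weight 1 := by
  rw [BoundedSSYT.weightMonomial, BoundedSSYT.weight, MvPolynomial.monomial_sum_one]
  rfl

/-- The multiset of weights of tableaux is invariant under permutations of the letters, since the
number of tableaux of a given weight is a coefficient of the symmetric polynomial `s_λ`. -/
theorem map_mapDomain_weight (lam : YoungDiagram) {n : ℕ} (σ : Equiv.Perm (Fin n)) :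
    (Finset.univ.val.map fun T : BoundedSSYT lam n => T.weight.mapDomain σ) =
      Finset.univ.val.map fun T : BoundedSSYT lam n => T.weight := by
  classical
  set W : Multiset (Fin n →₀ ℕ) := Finset.univ.val.map fun T : BoundedSSYT lam n => T.weight
    with hW
  have hcount : ∀ d, (W.count d : ℤ) = MvPolynomial.coeff d (schurPoly lam n) := by
    intro d
    rw [schurPoly, MvPolynomial.coeff_sum, hW, Multiset.count_map]
    simp only [BoundedSSYT.weightMonomial_eq, MvPolynomial.coeff_monomial]
    rw [Finset.sum_boole]
    simp only [eq_comm (a := d)]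
    rfl
  have hinj : Function.Injective (Finsupp.mapDomain σ : (Fin n →₀ ℕ) → _) :=
    Finsupp.mapDomain_injective σ.injective
  have hmap : (Finset.univ.val.map fun T : BoundedSSYT lam n => T.weight.mapDomain σ) =
      W.map (Finsupp.mapDomain σ) := by
    rw [hW, Multiset.map_map]
    rfl
  rw [hmap]
  ext d
  obtain ⟨e, rfl⟩ : ∃ e : Fin n →₀ ℕ, e.mapDomain σ = d :=
    ⟨d.mapDomain σ.symm, by rw [← Finsupp.mapDomain_comp]; simp⟩
  rw [Multiset.count_map_eq_count' _ _ hinj, ← Nat.cast_inj (R := ℤ), hcount, hcount,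
    ← MvPolynomial.coeff_rename_mapDomain σ σ.injective, isSymmetric_schurPoly lam n σ]

theorem isSymmetric_schurPlethysm (nu mu : YoungDiagram) (n : ℕ) :
    (schurPlethysm nu mu n).IsSymmetric := by
  intro σ
  rw [schurPlethysm, MvPolynomial.comp_aeval_apply]
  refine aeval_schurPoly_congr ?_ nu
  rw [completeSeriesOf, completeSeriesOf,
    Equiv.prod_comp (Fintype.equivFin (BoundedSSYT mu n)).symm (fun T => PowerSeries.mk fun k =>
      MvPolynomial.rename σ T.weightMonomial ^ k),
    Equiv.prod_comp (Fintype.equivFin (BoundedSSYT mu n)).symm (fun T => PowerSeries.mk fun k =>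
      T.weightMonomial ^ k)]
  have h := congrArg (fun W : Multiset (Fin n →₀ ℕ) => (W.map fun d => PowerSeries.mk fun k =>
    (MvPolynomial.monomial d (1 : ℤ)) ^ k).prod) (map_mapDomain_weight mu σ)
  simp only [Multiset.map_map, Function.comp_def] at h
  simp only [BoundedSSYT.weightMonomial_eq, MvPolynomial.rename_monomial]
  exact h

theorem isSchurExpansion_plethysmCoeff (n : ℕ) (nu mu : YoungDiagram) :
    IsSchurExpansion (schurPlethysm nu mu n) (plethysmCoeff n nu mu) := by
  have h := exists_isSchurExpansion (isSymmetric_schurPlethysm nu mu n)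
  rw [plethysmCoeff, dif_pos h]
  exact h.choose_spec

theorem eq_plethysmCoeff {n : ℕ} {nu mu : YoungDiagram} {c : PartitionLE n →₀ ℤ}
    (hc : IsSchurExpansion (schurPlethysm nu mu n) c) : c = plethysmCoeff n nu mu := by
  ext lam
  rw [hc.apply_eq, (isSchurExpansion_plethysmCoeff n nu mu).apply_eq]

/-! ### Series with denominators of the form `∏ (1 - x^a)` -/

section Rational

variable {σ : Type*}

/-- The geometric series `1 / (1 - x^a)`; it is used for `a ≠ 0` only. -/
noncomputable def geomSeries (a : σ →₀ ℕ) : MvPowerSeries σ ℚ :=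
  (1 - MvPowerSeries.monomial a 1)⁻¹

theorem one_sub_mul_geomSeries {a : σ →₀ ℕ} (ha : a ≠ 0) :
    (1 - MvPowerSeries.monomial a 1) * geomSeries a = 1 := by
  classical
  refine MvPowerSeries.mul_inv_cancel _ ?_
  rw [map_sub, map_one, ← MvPowerSeries.coeff_zero_eq_constantCoeff_apply,
    MvPowerSeries.coeff_monomial, if_neg ha.symm, sub_zero]
  exact one_ne_zero

/-- The series `x^c / ∏_{a ∈ s} (1 - x^a)`. -/
noncomputable def fracTerm (c : σ →₀ ℕ) (s : Multiset (σ →₀ ℕ)) : MvPowerSeries σ ℚ :=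
  MvPowerSeries.monomial c 1 * (s.map geomSeries).prod

/-- The linear combinations of series `x^c / ∏_{a ∈ s} (1 - x^a)` with nonconstant monomials
`x^a`. -/
noncomputable def fracSpan (σ : Type*) : Submodule ℚ (MvPowerSeries σ ℚ) :=
  Submodule.span ℚ {f | ∃ c s, (0 : σ →₀ ℕ) ∉ s ∧ f = fracTerm c s}

theorem fracTerm_mem {c : σ →₀ ℕ} {s : Multiset (σ →₀ ℕ)} (hs : 0 ∉ s) :
    fracTerm c s ∈ fracSpan σ :=
  Submodule.subset_span ⟨c, s, hs, rfl⟩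

theorem monomial_mul_fracTerm (d c : σ →₀ ℕ) (s : Multiset (σ →₀ ℕ)) :
    MvPowerSeries.monomial d 1 * fracTerm c s = fracTerm (d + c) s := by
  rw [fracTerm, fracTerm, ← mul_assoc, MvPowerSeries.monomial_mul_monomial, one_mul]

theorem coe_mul_mem_fracSpan (p : MvPolynomial σ ℚ) {f : MvPowerSeries σ ℚ}
    (hf : f ∈ fracSpan σ) : (p : MvPowerSeries σ ℚ) * f ∈ fracSpan σ := by
  induction hf using Submodule.span_induction with
  | mem f hf =>
    obtain ⟨c, s, hs, rfl⟩ := hf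
    induction p using MvPolynomial.induction_on' with
    | monomial d r =>
      have h : ((MvPolynomial.monomial d r : MvPolynomial σ ℚ) : MvPowerSeries σ ℚ) =
          r • MvPowerSeries.monomial d 1 := by
        rw [MvPolynomial.coe_monomial, ← map_smul, smul_eq_mul, mul_one]
      rw [h, smul_mul_assoc, monomial_mul_fracTerm]
      exact Submodule.smul_mem _ _ (fracTerm_mem hs)
    | add p q hp hq =>
      rw [MvPolynomial.coe_add, add_mul]
      exact Submodule.add_mem _ hp hq
  | zero => simp
  | add f g _ _ hf hg =>
    rw [mul_add]
    exact Submodule.add_mem _ hf hg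
  | smul r f _ hf =>
    rw [mul_smul_comm]
    exact Submodule.smul_mem _ _ hf

theorem isRationalSeries_fracTerm {c : σ →₀ ℕ} {s : Multiset (σ →₀ ℕ)} (hs : 0 ∉ s) :
    IsRationalSeries (fracTerm c s) := by
  classical
  refine ⟨MvPolynomial.monomial c 1, (s.map fun a => 1 - MvPolynomial.monomial a 1).prod, ?_, ?_⟩
  · rw [map_multiset_prod, Multiset.map_map, Multiset.map_congr rfl (g := fun _ => (1 : ℚ))]
    · simp
    · intro a ha
      have ha0 : a ≠ 0 := fun h => hs (h ▸ ha)
      simp [MvPolynomial.constantCoeff_monomial, ha0]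
  · rw [fracTerm, ← MvPolynomial.coeToMvPowerSeries.ringHom_apply, map_multiset_prod,
      Multiset.map_map, mul_left_comm, ← Multiset.prod_map_mul,
      Multiset.map_congr rfl (g := fun _ => (1 : MvPowerSeries σ ℚ))]
    · simp
    · intro a ha
      rw [Function.comp_apply, map_sub, map_one, MvPolynomial.coeToMvPowerSeries.ringHom_apply,
        MvPolynomial.coe_monomial, one_sub_mul_geomSeries fun h => hs (h ▸ ha)]

theorem isRationalSeries_of_mem_fracSpan {f : MvPowerSeries σ ℚ} (hf : f ∈ fracSpan σ) :
    IsRationalSeries f := by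
  induction hf using Submodule.span_induction with
  | mem f hf =>
    obtain ⟨c, s, hs, rfl⟩ := hf
    exact isRationalSeries_fracTerm hs
  | zero => exact ⟨0, 1, by simp, by simp⟩
  | add f g _ _ hf hg =>
    obtain ⟨P, Q, hQ, h⟩ := hf
    obtain ⟨P', Q', hQ', h'⟩ := hg
    refine ⟨Q' * P + Q * P', Q * Q', by simp [hQ, hQ'], ?_⟩
    simp only [MvPolynomial.coe_mul, MvPolynomial.coe_add, ← h, ← h']
    ring
  | smul r f _ hf =>
    obtain ⟨P, Q, hQ, h⟩ := hf
    exact ⟨r • P, Q, hQ, by rw [mul_smul_comm, h, MvPolynomial.coe_smul]⟩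

theorem isRationalSeries_of_monomial_mul {e : σ →₀ ℕ} {f : MvPowerSeries σ ℚ}
    (h : IsRationalSeries (MvPowerSeries.monomial e 1 * f)) : IsRationalSeries f := by
  obtain ⟨P, Q, hQ, hPQ⟩ := h
  refine ⟨P.divMonomial e, Q, hQ, ?_⟩
  ext d
  rw [MvPolynomial.coeff_coe, MvPolynomial.coeff_divMonomial, ← MvPolynomial.coeff_coe, ← hPQ,
    mul_left_comm, MvPowerSeries.coeff_add_monomial_mul, one_mul]

/-! ### Restriction to half-spaces -/

open Classical in
/-- The part of a power series supported on the exponents that satisfy `p`. -/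
noncomputable def restrictExponents (p : (σ →₀ ℕ) → Prop) :
    MvPowerSeries σ ℚ →ₗ[ℚ] MvPowerSeries σ ℚ where
  toFun f := fun d => if p d then MvPowerSeries.coeff d f else 0
  map_add' f g := by
    funext d
    show (if p d then MvPowerSeries.coeff d (f + g) else 0) =
      (if p d then MvPowerSeries.coeff d f else 0) + if p d then MvPowerSeries.coeff d g else 0
    split_ifs <;> simp
  map_smul' r f := by
    funext d
    show (if p d then MvPowerSeries.coeff d (r • f) else 0) =
      r • if p d then MvPowerSeries.coeff d f else 0
    split_ifs <;> simp

open Classical in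
theorem coeff_restrictExponents (p : (σ →₀ ℕ) → Prop) (f : MvPowerSeries σ ℚ) (d : σ →₀ ℕ) :
    MvPowerSeries.coeff d (restrictExponents p f) =
      if p d then MvPowerSeries.coeff d f else 0 := rfl

theorem le_of_coeff_mul_ne_zero {l : (σ →₀ ℕ) →+ ℤ} {b b' : ℤ} {f g : MvPowerSeries σ ℚ}
    (hf : ∀ d, MvPowerSeries.coeff d f ≠ 0 → b ≤ l d)
    (hg : ∀ d, MvPowerSeries.coeff d g ≠ 0 → b' ≤ l d) (d : σ →₀ ℕ)
    (h : MvPowerSeries.coeff d (f * g) ≠ 0) : b + b' ≤ l d := by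
  classical
  rw [MvPowerSeries.coeff_mul] at h
  obtain ⟨⟨d1, d2⟩, hd, hne⟩ := Finset.exists_ne_zero_of_sum_ne_zero h
  rw [Finset.HasAntidiagonal.mem_antidiagonal] at hd
  rw [← hd, map_add]
  exact add_le_add (hf _ (left_ne_zero_of_mul hne)) (hg _ (right_ne_zero_of_mul hne))

theorem nonneg_of_coeff_geomSeries_ne_zero {l : (σ →₀ ℕ) →+ ℤ} {a : σ →₀ ℕ} (ha : a ≠ 0)
    (hl : 0 ≤ l a) (d : σ →₀ ℕ) (h : MvPowerSeries.coeff d (geomSeries a) ≠ 0) : 0 ≤ l d := by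
  classical
  induction hk : d.degree using Nat.strong_induction_on generalizing d with
  | _ k ih =>
    have hgeom : geomSeries a = 1 + MvPowerSeries.monomial a 1 * geomSeries a := by
      linear_combination one_sub_mul_geomSeries ha
    rw [hgeom, map_add, MvPowerSeries.coeff_one, MvPowerSeries.coeff_monomial_mul] at h
    by_cases hd : d = 0
    · rw [hd, map_zero]
    rw [if_neg hd, zero_add, one_mul] at h
    split_ifs at h with had
    · have hda : d - a + a = d := tsub_add_cancel_of_le had
      have hdeg : (d - a).degree < k := by
        have h1 : (d - a).degree + a.degree = k := by rw [← map_add, hda, hk]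
        have h2 : a.degree ≠ 0 := fun h0 => ha ((Finsupp.degree_eq_zero_iff a).1 h0)
        omega
      have := ih _ hdeg (d - a) h rfl
      rw [← hda, map_add]
      omega
    · exact absurd rfl h

theorem le_of_coeff_fracTerm_ne_zero {l : (σ →₀ ℕ) →+ ℤ} {c : σ →₀ ℕ} {s : Multiset (σ →₀ ℕ)}
    (hs : 0 ∉ s) (hl : ∀ a ∈ s, 0 ≤ l a) (d : σ →₀ ℕ)
    (h : MvPowerSeries.coeff d (fracTerm c s) ≠ 0) : l c ≤ l d := by
  classical
  have hprod : ∀ d, MvPowerSeries.coeff d (s.map geomSeries).prod ≠ 0 → 0 ≤ l d := by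
    clear h
    induction s using Multiset.induction_on with
    | empty =>
      intro d hd
      rw [Multiset.map_zero, Multiset.prod_zero, MvPowerSeries.coeff_one] at hd
      rw [show d = 0 by by_contra h0; exact hd (if_neg h0), map_zero]
    | cons a s ih =>
      intro d hd
      rw [Multiset.map_cons, Multiset.prod_cons] at hd
      rw [Multiset.mem_cons, not_or] at hs
      have := le_of_coeff_mul_ne_zero (b := 0) (b' := 0)
        (nonneg_of_coeff_geomSeries_ne_zero (Ne.symm hs.1) (hl a (Multiset.mem_cons_self a s)))
        (ih hs.2 fun a ha => hl a (Multiset.mem_cons_of_mem ha)) d hd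
      simpa using this
  have := le_of_coeff_mul_ne_zero (b := l c) (b' := 0) (fun d hd => by
    rw [MvPowerSeries.coeff_monomial] at hd
    rw [show d = c by by_contra h0; exact hd (if_neg h0)]) hprod d h
  simpa using this

theorem fracTerm_cons {a : σ →₀ ℕ} (ha : a ≠ 0) (c : σ →₀ ℕ) (s : Multiset (σ →₀ ℕ)) :
    fracTerm c (a ::ₘ s) = fracTerm c s + fracTerm (c + a) (a ::ₘ s) := by
  have h : MvPowerSeries.monomial (c + a) (1 : ℚ) =
      MvPowerSeries.monomial c 1 * MvPowerSeries.monomial a 1 := by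
    rw [MvPowerSeries.monomial_mul_monomial, one_mul]
  simp only [fracTerm, Multiset.map_cons, Multiset.prod_cons, h]
  linear_combination (MvPowerSeries.monomial c 1 * (s.map geomSeries).prod) *
    one_sub_mul_geomSeries ha

/-- If the linear form `l` is nonnegative on all `a ∈ s`, then after finitely many steps of expanding
factors with `l a > 0`, every remaining term lies entirely inside or entirely outside the
half-space. -/
theorem restrictExponents_fracTerm_mem_of_nonneg (l : (σ →₀ ℕ) →+ ℤ) (b : ℤ) (c : σ →₀ ℕ)
    (s : Multiset (σ →₀ ℕ)) (hs : 0 ∉ s) (hl : ∀ a ∈ s, 0 ≤ l a) :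
    restrictExponents (fun d => b ≤ l d) (fracTerm c s) ∈ fracSpan σ := by
  classical
  induction hk : (b - l c).toNat + s.card using Nat.strong_induction_on generalizing c s with
  | _ k ih =>
    by_cases hc : b ≤ l c
    · have hid : restrictExponents (fun d => b ≤ l d) (fracTerm c s) = fracTerm c s := by
        ext d
        rw [coeff_restrictExponents]
        split_ifs with hd
        · rfl
        · by_contra h0
          exact hd (hc.trans (le_of_coeff_fracTerm_ne_zero hs hl d (Ne.symm h0)))
      rw [hid]
      exact fracTerm_mem hs
    by_cases hpos : ∃ a ∈ s, 0 < l a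
    · obtain ⟨a, has, hla⟩ := hpos
      obtain ⟨s, rfl⟩ := Multiset.exists_cons_of_mem has
      have ha : a ≠ 0 := fun h => hs (h ▸ has)
      rw [fracTerm_cons ha, map_add]
      rw [Multiset.card_cons] at hk
      refine Submodule.add_mem _ (ih _ ?_ c s (fun h => hs (Multiset.mem_cons_of_mem h))
        (fun a ha => hl a (Multiset.mem_cons_of_mem ha)) rfl) (ih _ ?_ (c + a) _ hs hl rfl)
      · omega
      · rw [Multiset.card_cons, map_add]
        omega
    · have hzero : restrictExponents (fun d => b ≤ l d) (fracTerm c s) = 0 := by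
        ext d
        rw [coeff_restrictExponents]
        split_ifs with hd
        · by_contra h0
          have hneg : ∀ a ∈ s, 0 ≤ (-l) a := fun a ha => by
            have : ¬ 0 < l a := fun h => hpos ⟨a, ha, h⟩
            rw [AddMonoidHom.neg_apply]
            omega
          have := le_of_coeff_fracTerm_ne_zero (l := -l) hs hneg d h0
          simp only [AddMonoidHom.neg_apply] at this
          omega
        · rfl
      rw [hzero]
      exact Submodule.zero_mem _

theorem geomSeries_eq_sum_mul {a : σ →₀ ℕ} (ha : a ≠ 0) {q : ℕ} (hq : q ≠ 0) :
    geomSeries a =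
      (∑ i ∈ Finset.range q, MvPowerSeries.monomial (i • a) 1) * geomSeries (q • a) := by
  have hqa : q • a ≠ 0 := smul_ne_zero hq ha
  have hpow : ∀ i : ℕ, MvPowerSeries.monomial (i • a) (1 : ℚ) = MvPowerSeries.monomial a 1 ^ i :=
    fun i => by rw [MvPowerSeries.monomial_pow, one_pow]
  have h1 := one_sub_mul_geomSeries ha
  have h2 := one_sub_mul_geomSeries hqa
  have h3 := mul_neg_geom_sum (MvPowerSeries.monomial a (1 : ℚ)) q
  simp only [hpow] at h2 ⊢
  linear_combination (-geomSeries a) * h2 + geomSeries a * geomSeries (q • a) * (-h3) +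
    (∑ i ∈ Finset.range q, MvPowerSeries.monomial a (1 : ℚ) ^ i) * geomSeries (q • a) * h1

/-- Elliott's identity `1 / ((1-u)(1-v)) = (1/(1-u) + 1/(1-v) - 1) / (1 - u v)`. -/
theorem geomSeries_mul_geomSeries {u v : σ →₀ ℕ} (hu : u ≠ 0) (hv : v ≠ 0) :
    geomSeries u * geomSeries v =
      geomSeries (u + v) * (geomSeries u + geomSeries v - 1) := by
  have huv : u + v ≠ 0 := fun h => hu (add_eq_zero.1 h).1
  have h1 := one_sub_mul_geomSeries hu
  have h2 := one_sub_mul_geomSeries hv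
  have h3 := one_sub_mul_geomSeries huv
  have hmul : MvPowerSeries.monomial (u + v) (1 : ℚ) =
      MvPowerSeries.monomial u 1 * MvPowerSeries.monomial v 1 := by
    rw [MvPowerSeries.monomial_mul_monomial, one_mul]
  rw [hmul] at h3
  set U := MvPowerSeries.monomial u (1 : ℚ)
  set V := MvPowerSeries.monomial v (1 : ℚ)
  have h4 : geomSeries u + geomSeries v - 1 = geomSeries u * geomSeries v * (1 - U * V) := by
    linear_combination (-geomSeries v) * h1 - geomSeries u * h2 +
      (1 - U) * geomSeries u * h2 + h1
  rw [h4]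
  linear_combination (-(geomSeries u * geomSeries v)) * h3

theorem exists_fracTerm_cons_cons_eq_sum {a a' : σ →₀ ℕ} (ha : a ≠ 0) (ha' : a' ≠ 0) {p q : ℕ}
    (hp : p ≠ 0) (hq : q ≠ 0) (c : σ →₀ ℕ) (s : Multiset (σ →₀ ℕ)) :
    fracTerm c (a ::ₘ a' ::ₘ s) = ∑ i ∈ Finset.range q, ∑ j ∈ Finset.range p,
      (fracTerm (c + i • a + j • a') ((q • a + p • a') ::ₘ (q • a) ::ₘ s) +
        fracTerm (c + i • a + j • a') ((q • a + p • a') ::ₘ (p • a') ::ₘ s) -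
        fracTerm (c + i • a + j • a') ((q • a + p • a') ::ₘ s)) := by
  have hmon : ∀ i j : ℕ, MvPowerSeries.monomial (c + i • a + j • a') (1 : ℚ) =
      MvPowerSeries.monomial c 1 * MvPowerSeries.monomial (i • a) 1 *
        MvPowerSeries.monomial (j • a') 1 := fun i j => by
    rw [MvPowerSeries.monomial_mul_monomial, MvPowerSeries.monomial_mul_monomial, one_mul, one_mul]
  have hterm : ∀ i j : ℕ,
      (fracTerm (c + i • a + j • a') ((q • a + p • a') ::ₘ (q • a) ::ₘ s) +
        fracTerm (c + i • a + j • a') ((q • a + p • a') ::ₘ (p • a') ::ₘ s) -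
        fracTerm (c + i • a + j • a') ((q • a + p • a') ::ₘ s)) =
      MvPowerSeries.monomial (i • a) 1 * MvPowerSeries.monomial (j • a') 1 *
        (MvPowerSeries.monomial c 1 * (geomSeries (q • a) * geomSeries (p • a')) *
          (s.map geomSeries).prod) := by
    intro i j
    rw [geomSeries_mul_geomSeries (smul_ne_zero hq ha) (smul_ne_zero hp ha')]
    simp only [fracTerm, Multiset.map_cons, Multiset.prod_cons, hmon]
    ring
  simp only [hterm]
  simp only [← Finset.sum_mul, ← Finset.sum_mul_sum]
  rw [fracTerm, Multiset.map_cons, Multiset.prod_cons, Multiset.map_cons, Multiset.prod_cons,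
    geomSeries_eq_sum_mul ha hq, geomSeries_eq_sum_mul ha' hp]
  ring

/-- Half-spaces preserve the span of the series `x^c / ∏ (1 - x^a)`. Two factors `a`, `a'` on which
the linear form has opposite signs are first replaced by multiples `u`, `v` on which it has opposite
values; then Elliott's identity lowers the number of factors on which the linear form does not
vanish, since it vanishes on `u + v`. -/
theorem restrictExponents_fracTerm_mem (l : (σ →₀ ℕ) →+ ℤ) (b : ℤ) (c : σ →₀ ℕ)
    (s : Multiset (σ →₀ ℕ)) (hs : 0 ∉ s) :
    restrictExponents (fun d => b ≤ l d) (fracTerm c s) ∈ fracSpan σ := by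
  classical
  induction hk : s.countP (fun a => l a ≠ 0) using Nat.strong_induction_on generalizing c s with
  | _ k ih =>
    by_cases hneg : ∃ a' ∈ s, l a' < 0
    · by_cases hpos : ∃ a ∈ s, 0 < l a
      · obtain ⟨a', has', hla'⟩ := hneg
        obtain ⟨a, has, hla⟩ := hpos
        have ha : a ≠ 0 := fun h => hs (h ▸ has)
        have ha' : a' ≠ 0 := fun h => hs (h ▸ has')
        obtain ⟨s, rfl⟩ := Multiset.exists_cons_of_mem has
        rw [Multiset.mem_cons] at has'
        have has'' : a' ∈ s := has'.resolve_left fun h => by rw [h] at hla'; omega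
        obtain ⟨s, rfl⟩ := Multiset.exists_cons_of_mem has''
        have hp : (l a).toNat ≠ 0 := by omega
        have hq : (-l a').toNat ≠ 0 := by omega
        have hs' : 0 ∉ s := fun h =>
          hs (Multiset.mem_cons_of_mem (Multiset.mem_cons_of_mem h))
        set u := (-l a').toNat • a with hu
        set v := (l a).toNat • a' with hv
        have hu0 : u ≠ 0 := smul_ne_zero hq ha
        have hv0 : v ≠ 0 := smul_ne_zero hp ha'
        have huv0 : u + v ≠ 0 := fun h => hu0 (add_eq_zero.1 h).1
        have huv : l (u + v) = 0 := by
          rw [hu, hv, map_add, map_nsmul, map_nsmul, nsmul_eq_mul, nsmul_eq_mul,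
            Int.toNat_of_nonneg (by omega), Int.toNat_of_nonneg (by omega)]
          ring
        rw [Multiset.countP_cons_of_pos (p := fun a => l a ≠ 0) _ hla.ne',
          Multiset.countP_cons_of_pos (p := fun a => l a ≠ 0) _ hla'.ne] at hk
        rw [exists_fracTerm_cons_cons_eq_sum ha ha' hp hq, map_sum]
        refine Submodule.sum_mem _ fun i _ => ?_
        rw [map_sum]
        refine Submodule.sum_mem _ fun j _ => ?_
        rw [map_sub, map_add]
        refine Submodule.sub_mem _ (Submodule.add_mem _ ?_ ?_) ?_
        · refine ih _ ?_ _ ((u + v) ::ₘ u ::ₘ s) ?_ rfl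
          · rw [Multiset.countP_cons_of_neg _ (by simpa using huv), Multiset.countP_cons]
            split_ifs <;> omega
          · simp [huv0.symm, hu0.symm, hs']
        · refine ih _ ?_ _ ((u + v) ::ₘ v ::ₘ s) ?_ rfl
          · rw [Multiset.countP_cons_of_neg _ (by simpa using huv), Multiset.countP_cons]
            split_ifs <;> omega
          · simp [huv0.symm, hv0.symm, hs']
        · refine ih _ ?_ _ ((u + v) ::ₘ s) ?_ rfl
          · rw [Multiset.countP_cons_of_neg _ (by simpa using huv)]
            omega
          · simp [huv0.symm, hs']
      · -- The form is nonpositive on all factors: pass to the complementary half-space.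
        have hcompl : restrictExponents (fun d => b ≤ l d) (fracTerm c s) = fracTerm c s -
            restrictExponents (fun d => 1 - b ≤ (-l) d) (fracTerm c s) := by
          ext d
          rw [map_sub, coeff_restrictExponents, coeff_restrictExponents, AddMonoidHom.neg_apply]
          split_ifs with h1 h2 h2
          · omega
          · rw [sub_zero]
          · rw [sub_self]
          · omega
        rw [hcompl]
        refine Submodule.sub_mem _ (fracTerm_mem hs)
          (restrictExponents_fracTerm_mem_of_nonneg _ _ _ _ hs fun a ha => ?_)
        have : ¬ 0 < l a := fun h => hpos ⟨a, ha, h⟩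
        rw [AddMonoidHom.neg_apply]
        omega
    · exact restrictExponents_fracTerm_mem_of_nonneg l b c s hs fun a ha =>
        not_lt.1 fun h => hneg ⟨a, ha, h⟩

theorem restrictExponents_halfspace_mem (l : (σ →₀ ℕ) →+ ℤ) (b : ℤ) {f : MvPowerSeries σ ℚ}
    (hf : f ∈ fracSpan σ) : restrictExponents (fun d => b ≤ l d) f ∈ fracSpan σ := by
  induction hf using Submodule.span_induction with
  | mem f hf =>
    obtain ⟨c, s, hs, rfl⟩ := hf
    exact restrictExponents_fracTerm_mem l b c s hs
  | zero => simp
  | add f g _ _ hf hg =>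
    rw [map_add]
    exact Submodule.add_mem _ hf hg
  | smul r f _ hf =>
    rw [map_smul]
    exact Submodule.smul_mem _ _ hf

theorem restrictExponents_polyhedron_mem {ι : Type*} (t : Finset ι) (l : ι → (σ →₀ ℕ) →+ ℤ)
    (b : ι → ℤ) {f : MvPowerSeries σ ℚ} (hf : f ∈ fracSpan σ) :
    restrictExponents (fun d => ∀ i ∈ t, b i ≤ l i d) f ∈ fracSpan σ := by
  classical
  induction t using Finset.induction_on with
  | empty =>
    have h : restrictExponents (fun d => ∀ i ∈ (∅ : Finset ι), b i ≤ l i d) f = f := by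
      ext d
      rw [coeff_restrictExponents, if_pos (by simp)]
    rwa [h]
  | insert i t _ ih =>
    have h : restrictExponents (fun d => ∀ j ∈ insert i t, b j ≤ l j d) f =
        restrictExponents (fun d => b i ≤ l i d)
          (restrictExponents (fun d => ∀ j ∈ t, b j ≤ l j d) f) := by
      ext d
      simp only [coeff_restrictExponents, Finset.forall_mem_insert]
      split_ifs <;> tauto
    rw [h]
    exact restrictExponents_halfspace_mem _ _ ih

end Rational

/-! ### Power series in two groups of variables -/

theorem sumElim_inj {α β : Type*} {d d' : α →₀ ℕ} {e e' : β →₀ ℕ} :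
    d.sumElim e = d'.sumElim e' ↔ d = d' ∧ e = e' := by
  constructor
  · intro h
    exact ⟨Finsupp.ext fun i => DFunLike.congr_fun h (Sum.inl i),
      Finsupp.ext fun i => DFunLike.congr_fun h (Sum.inr i)⟩
  · rintro ⟨rfl, rfl⟩
    rfl

/-- The underlying function of `splitSeries`. -/
def splitSeriesFun {α β R : Type*} [CommRing R] (F : MvPowerSeries (α ⊕ β) R) :
    MvPowerSeries β (MvPowerSeries α R) :=
  fun e => (fun d => MvPowerSeries.coeff (d.sumElim e) F : MvPowerSeries α R)

theorem coeff_coeff_splitSeriesFun {α β R : Type*} [CommRing R] (F : MvPowerSeries (α ⊕ β) R)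
    (d : α →₀ ℕ) (e : β →₀ ℕ) :
    MvPowerSeries.coeff d (MvPowerSeries.coeff e (splitSeriesFun F)) =
      MvPowerSeries.coeff (d.sumElim e) F := rfl

theorem splitSeriesFun_mul {α β R : Type*} [CommRing R] (F G : MvPowerSeries (α ⊕ β) R) :
    splitSeriesFun (F * G) = splitSeriesFun F * splitSeriesFun G := by
  classical
  ext e d
  rw [coeff_coeff_splitSeriesFun, MvPowerSeries.coeff_mul, MvPowerSeries.coeff_mul, map_sum]
  simp only [MvPowerSeries.coeff_mul, coeff_coeff_splitSeriesFun]
  rw [← Finset.sum_product', ← Finsupp.image_sumElim_product_antidiagonal, Finset.sum_image]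
  · exact Finset.sum_bij' (fun p _ => (p.2, p.1)) (fun p _ => (p.2, p.1))
      (by simp [and_comm]) (by simp [and_comm]) (by simp) (by simp) (fun _ _ => rfl)
  · rintro ⟨⟨a, b⟩, c, d⟩ _ ⟨⟨a', b'⟩, c', d'⟩ _ h
    simp only [Prod.mk.injEq, sumElim_inj] at h ⊢
    tauto

theorem splitSeriesFun_one {α β R : Type*} [CommRing R] :
    splitSeriesFun (1 : MvPowerSeries (α ⊕ β) R) = 1 := by
  classical
  ext e d
  have h : d.sumElim e = 0 ↔ d = 0 ∧ e = 0 := by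
    rw [← Finsupp.sumElim_zero_zero, sumElim_inj]
  rw [coeff_coeff_splitSeriesFun, MvPowerSeries.coeff_one, MvPowerSeries.coeff_one,
    if_congr h rfl rfl]
  by_cases he : e = 0 <;> by_cases hd : d = 0 <;> simp [he, hd, MvPowerSeries.coeff_one]

/-- A power series in two groups of variables, as a power series in the second group whose
coefficients are power series in the first group. -/
def splitSeries {α β R : Type*} [CommRing R] :
    MvPowerSeries (α ⊕ β) R →+* MvPowerSeries β (MvPowerSeries α R) where
  toFun := splitSeriesFun
  map_one' := splitSeriesFun_one
  map_mul' := splitSeriesFun_mul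
  map_zero' := rfl
  map_add' _ _ := rfl

theorem coeff_coeff_splitSeries {α β R : Type*} [CommRing R] (F : MvPowerSeries (α ⊕ β) R)
    (d : α →₀ ℕ) (e : β →₀ ℕ) :
    MvPowerSeries.coeff d (MvPowerSeries.coeff e (splitSeries F)) =
      MvPowerSeries.coeff (d.sumElim e) F := rfl

theorem splitSeries_monomial {α β R : Type*} [CommRing R] (d : α →₀ ℕ) (e : β →₀ ℕ) (r : R) :
    splitSeries (MvPowerSeries.monomial (d.sumElim e) r) =
      MvPowerSeries.monomial e (MvPowerSeries.monomial d r) := by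
  classical
  ext e' d'
  rw [coeff_coeff_splitSeries, MvPowerSeries.coeff_monomial, MvPowerSeries.coeff_monomial]
  by_cases he : e' = e
  · by_cases hd : d' = d
    · simp [he, hd]
    · rw [if_neg fun h => hd (sumElim_inj.1 h).1, if_pos he, MvPowerSeries.coeff_monomial,
        if_neg hd]
  · rw [if_neg fun h => he (sumElim_inj.1 h).2, if_neg he, map_zero]

/-- A power series in one variable, as a power series in the variable `j` of a family. -/
noncomputable def singleVarSeries {A : Type*} [CommRing A] {m : ℕ} (j : Fin m) :
    PowerSeries A →+* MvPowerSeries (Fin m) A :=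
  (MvPowerSeries.rename (R := A) (fun _ : Unit => j)).toRingHom

theorem coeff_singleVarSeries {A : Type*} [CommRing A] {m : ℕ} (j : Fin m) (G : PowerSeries A)
    (k : ℕ) : MvPowerSeries.coeff (Finsupp.single j k) (singleVarSeries j G) =
      PowerSeries.coeff k G := by
  have h := MvPowerSeries.coeff_embDomain_rename (R := A)
    (⟨fun _ : Unit => j, fun _ _ _ => rfl⟩ : Unit ↪ Fin m) G (Finsupp.single () k)
  rw [Finsupp.embDomain_single] at h
  exact h

theorem coeff_singleVarSeries_eq_zero {A : Type*} [CommRing A] {m : ℕ} (j : Fin m)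
    (G : PowerSeries A) {e : Fin m →₀ ℕ} (he : ∀ k, e ≠ Finsupp.single j k) :
    MvPowerSeries.coeff e (singleVarSeries j G) = 0 := by
  refine MvPowerSeries.coeff_rename_eq_zero _ _ ?_
  rintro ⟨x, rfl⟩
  refine he (x ()) ?_
  have hx : x = Finsupp.single () (x ()) := by ext; simp
  rw [hx, Finsupp.mapDomain_single, Finsupp.single_eq_same]

theorem singleVarSeries_X {A : Type*} [CommRing A] {m : ℕ} (j : Fin m) :
    singleVarSeries j (PowerSeries.X : PowerSeries A) = MvPowerSeries.X j :=
  MvPowerSeries.rename_X _ _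

theorem singleVarSeries_C {A : Type*} [CommRing A] {m : ℕ} (j : Fin m) (a : A) :
    singleVarSeries j (PowerSeries.C a) = MvPowerSeries.C a :=
  MvPowerSeries.rename_C _ _

theorem coeff_prod_singleVarSeries {A : Type*} [CommRing A] {m : ℕ} (G : Fin m → PowerSeries A)
    (e : Fin m →₀ ℕ) :
    MvPowerSeries.coeff e (∏ j, singleVarSeries j (G j)) =
      ∏ j, PowerSeries.coeff (e j) (G j) := by
  classical
  let l0 : Fin m →₀ Fin m →₀ ℕ :=
    Finsupp.equivFunOnFinite.symm fun j => Finsupp.single j (e j)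
  rw [MvPowerSeries.coeff_prod, Finset.sum_eq_single l0]
  · exact Finset.prod_congr rfl fun j _ => coeff_singleVarSeries j (G j) (e j)
  · intro l hl hne
    by_contra h0
    have hk : ∀ j, ∃ k, l j = Finsupp.single j k := fun j => by
      by_contra hk
      push Not at hk
      exact h0 (Finset.prod_eq_zero (Finset.mem_univ j)
        (coeff_singleVarSeries_eq_zero j (G j) hk))
    choose k hk using hk
    have hsum := (Finset.mem_finsuppAntidiag.1 hl).1
    apply hne
    ext1 j
    have : k j = e j := by
      rw [← hsum, Finsupp.finsetSum_apply]
      simp [hk, Finsupp.single_apply]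
    rw [hk j, this]
    rfl
  · intro h
    exfalso
    refine h (Finset.mem_finsuppAntidiag.2 ⟨?_, fun _ _ => Finset.mem_univ _⟩)
    ext j
    rw [Finsupp.finsetSum_apply]
    simp [l0, Finsupp.single_apply]

theorem coeff_det_singleVarSeries {A : Type*} [CommRing A] {m : ℕ} (G : Fin m → PowerSeries A)
    (e : Fin m →₀ ℕ) :
    MvPowerSeries.coeff e (Matrix.det (Matrix.of fun i j => singleVarSeries j (G i))) =
      Matrix.det (Matrix.of fun i j => PowerSeries.coeff (e j) (G i)) := by
  rw [Matrix.det_apply', Matrix.det_apply', map_sum]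
  refine Finset.sum_congr rfl fun σ _ => ?_
  simp only [Matrix.of_apply]
  rw [← coeff_prod_singleVarSeries, ← zsmul_eq_mul, ← zsmul_eq_mul, map_zsmul]

/-! ### The generating function of plethysm coefficients -/

/-- The ring homomorphism from integral polynomials to rational power series. -/
noncomputable def toRatSeries (σ : Type*) : MvPolynomial σ ℤ →+* MvPowerSeries σ ℚ :=
  MvPolynomial.coeToMvPowerSeries.ringHom.comp (MvPolynomial.map (Int.castRingHom ℚ))

theorem coeff_toRatSeries {σ : Type*} (p : MvPolynomial σ ℤ) (d : σ →₀ ℕ) :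
    MvPowerSeries.coeff d (toRatSeries σ p) = ((MvPolynomial.coeff d p : ℤ) : ℚ) := by
  simp [toRatSeries, MvPolynomial.coeff_map]

theorem toRatSeries_monomial {σ : Type*} (d : σ →₀ ℕ) :
    toRatSeries σ (MvPolynomial.monomial d 1) = MvPowerSeries.monomial d 1 := by
  simp [toRatSeries]

theorem toRatSeries_X {σ : Type*} (i : σ) :
    toRatSeries σ (MvPolynomial.X i) = MvPowerSeries.X i := by
  simp [toRatSeries]

theorem toRatSeries_mul_mem_fracSpan {σ : Type*} (p : MvPolynomial σ ℤ) {f : MvPowerSeries σ ℚ}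
    (hf : f ∈ fracSpan σ) : toRatSeries σ p * f ∈ fracSpan σ :=
  coe_mul_mem_fracSpan (MvPolynomial.map (Int.castRingHom ℚ) p) hf

/-- The Cauchy kernel `∏_{T,j} 1 / (1 - x^{wt(T)} y_j)`, where `T` runs through the tableaux of
shape `μ` over an alphabet of `n` letters. -/
noncomputable def cauchyKernel (n m : ℕ) (mu : YoungDiagram) :
    MvPowerSeries (Fin n ⊕ Fin m) ℚ :=
  ∏ T : BoundedSSYT mu n, ∏ j : Fin m, geomSeries (T.weight.sumElim (Finsupp.single j 1))

theorem sumElim_single_ne_zero {n m : ℕ} (d : Fin n →₀ ℕ) (j : Fin m) :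
    d.sumElim (Finsupp.single j 1) ≠ 0 := by
  intro h
  have := DFunLike.congr_fun h (Sum.inr j)
  simp at this

theorem cauchyKernel_mem_fracSpan (n m : ℕ) (mu : YoungDiagram) :
    cauchyKernel n m mu ∈ fracSpan (Fin n ⊕ Fin m) := by
  have h : cauchyKernel n m mu = fracTerm 0
      ((Finset.univ : Finset (BoundedSSYT mu n × Fin m)).val.map fun p =>
        p.1.weight.sumElim (Finsupp.single p.2 1)) := by
    rw [fracTerm, MvPowerSeries.monomial_zero_one, one_mul, Multiset.map_map, cauchyKernel,
      ← Fintype.prod_prod_type']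
    rfl
  rw [h]
  refine fracTerm_mem fun h0 => ?_
  obtain ⟨p, -, hp⟩ := Multiset.mem_map.1 h0
  exact sumElim_single_ne_zero _ _ hp

theorem splitSeries_geomSeries {n m : ℕ} (d : Fin n →₀ ℕ) (j : Fin m) :
    splitSeries (geomSeries (d.sumElim (Finsupp.single j 1))) =
      singleVarSeries j (PowerSeries.mk fun k => (MvPowerSeries.monomial d (1 : ℚ)) ^ k) := by
  have h1 := congrArg splitSeries (one_sub_mul_geomSeries (sumElim_single_ne_zero d j))
  have h2 := congrArg (singleVarSeries j)
    (geometric_mul_one_sub (MvPowerSeries.monomial d (1 : ℚ)))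
  rw [map_mul, map_sub, map_one, splitSeries_monomial] at h1
  rw [map_mul, map_sub, map_one (singleVarSeries j), map_mul, singleVarSeries_C,
    singleVarSeries_X] at h2
  have h3 : MvPowerSeries.monomial (Finsupp.single j 1) (MvPowerSeries.monomial d (1 : ℚ)) =
      MvPowerSeries.C (MvPowerSeries.monomial d 1) * MvPowerSeries.X j := by
    rw [MvPowerSeries.X_def, ← MvPowerSeries.monomial_zero_eq_C_apply,
      MvPowerSeries.monomial_mul_monomial, zero_add, mul_one]
  rw [h3] at h1
  generalize splitSeries (geomSeries (d.sumElim (Finsupp.single j 1))) = a at h1 ⊢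
  linear_combination (-a) * h2 +
    (singleVarSeries j (PowerSeries.mk fun k => (MvPowerSeries.monomial d (1 : ℚ)) ^ k)) * h1

theorem splitSeries_cauchyKernel (n m : ℕ) (mu : YoungDiagram) :
    splitSeries (cauchyKernel n m mu) = ∏ j : Fin m, singleVarSeries j
      (completeSeriesOf fun T : BoundedSSYT mu n => MvPowerSeries.monomial T.weight (1 : ℚ)) := by
  rw [cauchyKernel, Finset.prod_comm, map_prod]
  refine Finset.prod_congr rfl fun j _ => ?_
  rw [map_prod, completeSeriesOf, map_prod]
  exact Finset.prod_congr rfl fun T _ => splitSeries_geomSeries _ _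

theorem map_aeval_int {A B τ : Type*} [CommRing A] [CommRing B] [Algebra ℤ A] [Algebra ℤ B]
    (g : A →+* B) (f : τ → A) (p : MvPolynomial τ ℤ) :
    g (MvPolynomial.aeval f p) = MvPolynomial.aeval (fun i => g (f i)) p := by
  induction p using MvPolynomial.induction_on with
  | C a => simp
  | add p q hp hq => simp [hp, hq]
  | mul_X p i hp => simp [hp]

theorem toRatSeries_schurPlethysm {n m : ℕ} (mu : YoungDiagram) {nu : YoungDiagram}
    (hn : nu.colLen 0 ≤ m) :
    toRatSeries (Fin n) (schurPlethysm nu mu n) =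
      Matrix.det (Matrix.of fun i j : Fin m => PowerSeries.coeff (shiftedParts nu m i)
        (PowerSeries.X ^ (Fin.rev j : ℕ) * completeSeriesOf fun T : BoundedSSYT mu n =>
          MvPowerSeries.monomial T.weight (1 : ℚ))) := by
  have hser : completeSeriesOf (fun k : Fin (Fintype.card (BoundedSSYT mu n)) =>
      toRatSeries (Fin n) ((Fintype.equivFin (BoundedSSYT mu n)).symm k).weightMonomial) =
      completeSeriesOf fun T : BoundedSSYT mu n => MvPowerSeries.monomial T.weight (1 : ℚ) := by
    simp only [completeSeriesOf, BoundedSSYT.weightMonomial_eq, toRatSeries_monomial]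
    exact Equiv.prod_comp (Fintype.equivFin (BoundedSSYT mu n)).symm fun T =>
      PowerSeries.mk fun k => MvPowerSeries.monomial T.weight (1 : ℚ) ^ k
  rw [← hser, schurPlethysm, map_aeval_int, aeval_schurPoly_eq_det _ hn]

/-- The product of the Vandermonde determinants in both groups of variables with the Cauchy
kernel. -/
noncomputable def alternatingKernel (n m : ℕ) (mu : YoungDiagram) :
    MvPowerSeries (Fin n ⊕ Fin m) ℚ :=
  toRatSeries _ (MvPolynomial.rename Sum.inl (vandermondePoly n) *
    MvPolynomial.rename Sum.inr (vandermondePoly m)) * cauchyKernel n m mu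

theorem alternatingKernel_mem_fracSpan (n m : ℕ) (mu : YoungDiagram) :
    alternatingKernel n m mu ∈ fracSpan (Fin n ⊕ Fin m) :=
  toRatSeries_mul_mem_fracSpan _ (cauchyKernel_mem_fracSpan n m mu)

theorem splitSeries_rename_inl {n m : ℕ} (p : MvPolynomial (Fin n) ℤ) :
    splitSeries (toRatSeries (Fin n ⊕ Fin m) (MvPolynomial.rename Sum.inl p)) =
      MvPowerSeries.C (toRatSeries (Fin n) p) := by
  have h : (splitSeries.comp (toRatSeries (Fin n ⊕ Fin m))).comp
      (MvPolynomial.rename (R := ℤ) Sum.inl).toRingHom =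
      MvPowerSeries.C.comp (toRatSeries (Fin n)) := by
    refine MvPolynomial.ringHom_ext' (RingHom.ext_int _ _) fun i => ?_
    have h1 : MvPowerSeries.X (R := ℚ) (Sum.inl i : Fin n ⊕ Fin m) =
        MvPowerSeries.monomial ((Finsupp.single i 1).sumElim 0) 1 := by
      rw [Finsupp.sumElim_single_zero, MvPowerSeries.X_def]
    simp only [RingHom.comp_apply, AlgHom.toRingHom_eq_coe, RingHom.coe_coe,
      MvPolynomial.rename_X, toRatSeries_X]
    rw [h1, splitSeries_monomial, MvPowerSeries.monomial_zero_eq_C_apply, MvPowerSeries.X_def]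
  exact congrArg (fun g : _ →+* _ => g p) h

theorem splitSeries_X_inr {n m : ℕ} (j : Fin m) :
    splitSeries (MvPowerSeries.X (R := ℚ) (Sum.inr j : Fin n ⊕ Fin m)) = MvPowerSeries.X j := by
  rw [MvPowerSeries.X_def, ← Finsupp.sumElim_zero_single, splitSeries_monomial,
    MvPowerSeries.monomial_zero_one, MvPowerSeries.X_def]

/-- The coefficients of `a_ρ(y) ∏ 1 / (1 - x^{wt(T)} y_j)` with respect to `y` at the exponents
`ν + ρ` are the Jacobi–Trudi determinants of the plethysms `s_ν[s_μ]`. -/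
theorem coeff_splitSeries_vandermonde_mul_cauchyKernel {n m : ℕ} (mu : YoungDiagram)
    (nu : PartitionLE m) :
    MvPowerSeries.coeff (shiftedExponent nu) (splitSeries
      (toRatSeries (Fin n ⊕ Fin m) (MvPolynomial.rename Sum.inr (vandermondePoly m)) *
        cauchyKernel n m mu)) = toRatSeries (Fin n) (schurPlethysm nu.1 mu n) := by
  set H := completeSeriesOf fun T : BoundedSSYT mu n => MvPowerSeries.monomial T.weight (1 : ℚ)
    with hH
  have hv : splitSeries (toRatSeries (Fin n ⊕ Fin m)
      (MvPolynomial.rename Sum.inr (vandermondePoly m))) = Matrix.det (Matrix.of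
        fun i j : Fin m => (MvPowerSeries.X j : MvPowerSeries (Fin m) (MvPowerSeries (Fin n) ℚ)) ^
          (Fin.rev i : ℕ)) := by
    rw [vandermondePoly, alternant, AlgHom.map_det, RingHom.map_det, RingHom.map_det]
    congr 1
    refine Matrix.ext fun i j => ?_
    simp [toRatSeries_X, splitSeries_X_inr]
  have hdet : splitSeries (toRatSeries (Fin n ⊕ Fin m)
      (MvPolynomial.rename Sum.inr (vandermondePoly m)) * cauchyKernel n m mu) =
      Matrix.det (Matrix.of fun i j : Fin m =>
        singleVarSeries j (PowerSeries.X ^ (Fin.rev i : ℕ) * H)) := by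
    rw [map_mul, hv, splitSeries_cauchyKernel, mul_comm, ← Matrix.det_mul_row]
    congr 1
    refine Matrix.ext fun i j => ?_
    simp [singleVarSeries_X, hH, mul_comm]
  rw [hdet, coeff_det_singleVarSeries, toRatSeries_schurPlethysm mu nu.2, ← Matrix.det_transpose]
  rfl

/-- The coefficient of `x^{λ+ρ} y^{ν+ρ}` in the alternating kernel is `a^λ_{ν[μ]}`. -/
theorem coeff_alternatingKernel {n m : ℕ} (mu : YoungDiagram) (lam : PartitionLE n)
    (nu : PartitionLE m) :
    MvPowerSeries.coeff ((shiftedExponent lam).sumElim (shiftedExponent nu))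
      (alternatingKernel n m mu) = (plethysmCoeff n nu.1 mu lam : ℚ) := by
  rw [← coeff_coeff_splitSeries, alternatingKernel, map_mul (toRatSeries _), mul_assoc,
    map_mul splitSeries,
    splitSeries_rename_inl, MvPowerSeries.coeff_C_mul,
    coeff_splitSeries_vandermonde_mul_cauchyKernel, ← map_mul, coeff_toRatSeries,
    (isSchurExpansion_plethysmCoeff n nu.1 mu).apply_eq lam]

theorem pairExponent_add_rho {n m : ℕ} (lam : PartitionLE n) (nu : PartitionLE m) :
    Finsupp.equivFunOnFinite.symm (Sum.elim (fun i : Fin n => (Fin.rev i : ℕ))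
      fun j : Fin m => (Fin.rev j : ℕ)) + pairExponent lam nu =
      (shiftedExponent lam).sumElim (shiftedExponent nu) := by
  ext (i | j)
  · exact Nat.add_comm _ _
  · exact Nat.add_comm _ _

theorem pairExponent_inj {n m : ℕ} {lam lam' : PartitionLE n} {nu nu' : PartitionLE m} :
    pairExponent lam nu = pairExponent lam' nu' ↔ lam = lam' ∧ nu = nu' := by
  constructor
  · intro h
    have h1 := pairExponent_add_rho lam nu
    rw [h, pairExponent_add_rho, sumElim_inj] at h1
    exact ⟨shiftedExponent_injective n h1.1.symm, shiftedExponent_injective m h1.2.symm⟩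
  · rintro ⟨rfl, rfl⟩
    rfl

theorem coeff_plethysmSeries_pairExponent {n m : ℕ} (mu : YoungDiagram) (lam : PartitionLE n)
    (nu : PartitionLE m) :
    MvPowerSeries.coeff (pairExponent lam nu) (plethysmSeries n m mu) =
      (plethysmCoeff n nu.1 mu lam : ℚ) := by
  refine (finsum_eq_single _ (lam, nu) fun p hp => ?_).trans
    (MvPowerSeries.coeff_monomial_same _ _)
  refine MvPowerSeries.coeff_monomial_ne (fun h => hp ?_) _
  obtain ⟨h1, h2⟩ := pairExponent_inj.1 h
  rw [h1, h2]

theorem coeff_plethysmSeries_eq_zero {n m : ℕ} (mu : YoungDiagram) {d : Fin n ⊕ Fin m →₀ ℕ}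
    (hd : ∀ lam nu, d ≠ pairExponent lam nu) :
    MvPowerSeries.coeff d (plethysmSeries n m mu) = 0 :=
  finsum_eq_zero_of_forall_eq_zero fun p => MvPowerSeries.coeff_monomial_ne (hd p.1 p.2) _

/-- On the exponents that decrease strictly in both groups of variables, the alternating kernel is
`x^ρ y^ρ` times the generating function of the plethysm coefficients. (The order on
`Fin n ⊕ Fin m` does not compare the two groups.) -/
theorem restrictExponents_alternatingKernel (n m : ℕ) (mu : YoungDiagram) :
    restrictExponents (fun d => StrictAnti d) (alternatingKernel n m mu) =
      MvPowerSeries.monomial (Finsupp.equivFunOnFinite.symm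
        (Sum.elim (fun i : Fin n => (Fin.rev i : ℕ)) fun j : Fin m => (Fin.rev j : ℕ))) 1 *
        plethysmSeries n m mu := by
  classical
  ext d
  rw [coeff_restrictExponents]
  split_ifs with hd
  · obtain ⟨lam, hlam⟩ := exists_shiftedExponent_eq
      (d := Finsupp.equivFunOnFinite.symm fun i : Fin n => d (Sum.inl i))
      fun i j hij => hd (Sum.inl_lt_inl_iff.2 hij)
    obtain ⟨nu, hnu⟩ := exists_shiftedExponent_eq
      (d := Finsupp.equivFunOnFinite.symm fun i : Fin m => d (Sum.inr i))
      fun i j hij => hd (Sum.inr_lt_inr_iff.2 hij)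
    have h : d = (shiftedExponent lam).sumElim (shiftedExponent nu) := by
      rw [hlam, hnu]
      ext (i | j) <;> rfl
    rw [h, coeff_alternatingKernel, ← pairExponent_add_rho, MvPowerSeries.coeff_add_monomial_mul,
      one_mul, coeff_plethysmSeries_pairExponent]
  · rw [MvPowerSeries.coeff_monomial_mul]
    split_ifs with hle
    · by_contra h0
      have hpair : ¬ ∀ lam nu, d - _ ≠ pairExponent lam nu := fun h =>
        h0 (by rw [coeff_plethysmSeries_eq_zero mu h, mul_zero])
      push Not at hpair
      obtain ⟨lam, nu, h⟩ := hpair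
      have hsum := pairExponent_add_rho lam nu
      rw [← h, add_tsub_cancel_of_le hle] at hsum
      refine hd ?_
      rw [hsum]
      rintro (i | i) (j | j) hij
      · exact shiftedExponent_strictAnti lam (Sum.inl_lt_inl_iff.1 hij)
      · exact absurd hij Sum.not_inl_lt_inr
      · exact absurd hij Sum.not_inr_lt_inl
      · exact shiftedExponent_strictAnti nu (Sum.inr_lt_inr_iff.1 hij)
    · rfl

theorem isRationalSeries_plethysmSeries (n m : ℕ) (mu : YoungDiagram) :
    IsRationalSeries (plethysmSeries n m mu) := by
  classical
  let ev : Fin n ⊕ Fin m → (Fin n ⊕ Fin m →₀ ℕ) →+ ℤ := fun x =>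
    (Nat.castAddMonoidHom ℤ).comp (Finsupp.applyAddHom x)
  have h := restrictExponents_polyhedron_mem
    (Finset.univ.filter fun p : (Fin n ⊕ Fin m) × (Fin n ⊕ Fin m) => p.1 < p.2)
    (fun p => ev p.1 - ev p.2) (fun _ => 1) (alternatingKernel_mem_fracSpan n m mu)
  have hpred : (fun d : Fin n ⊕ Fin m →₀ ℕ => ∀ p ∈ Finset.univ.filter
      (fun p : (Fin n ⊕ Fin m) × (Fin n ⊕ Fin m) => p.1 < p.2), 1 ≤ (ev p.1 - ev p.2) d) =
      fun d : Fin n ⊕ Fin m →₀ ℕ => StrictAnti d := by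
    funext d
    refine propext ⟨fun hd x y hxy => ?_, fun hd p hp => ?_⟩
    · have h1 : (1 : ℤ) ≤ (d x : ℤ) - d y := hd (x, y) (by simpa using hxy)
      omega
    · have h1 := hd (Finset.mem_filter.1 hp).2
      show (1 : ℤ) ≤ (d p.1 : ℤ) - d p.2
      omega
  rw [hpred, restrictExponents_alternatingKernel] at h
  exact isRationalSeries_of_monomial_mul (isRationalSeries_of_mem_fracSpan h)

/-! ### Linear recurrence -/

theorem plethysmCoeffVec_natCast {n m : ℕ} (mu : YoungDiagram) (d : Fin n ⊕ Fin m →₀ ℕ) :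
    (plethysmCoeffVec mu (fun i : Fin n => (d (Sum.inl i) : ℤ))
      (fun j : Fin m => (d (Sum.inr j) : ℤ)) : ℚ) =
      MvPowerSeries.coeff d (plethysmSeries n m mu) := by
  classical
  have h := (Int.castAddHom ℚ).map_finsum_of_injective Int.cast_injective
    (fun p : PartitionLE n × PartitionLE m =>
      if (∀ i : Fin n, (d (Sum.inl i) : ℤ) = p.1.1.rowLen i) ∧
        (∀ j : Fin m, (d (Sum.inr j) : ℤ) = p.2.1.rowLen j)
      then plethysmCoeff n p.2.1 mu p.1 else 0)
  rw [plethysmCoeffVec]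
  refine Eq.trans ?_ (h.trans (finsum_congr fun p => ?_))
  · rw [Int.coe_castAddHom]
  · have hiff : d = pairExponent p.1 p.2 ↔ (∀ i : Fin n, (d (Sum.inl i) : ℤ) = p.1.1.rowLen i) ∧
        (∀ j : Fin m, (d (Sum.inr j) : ℤ) = p.2.1.rowLen j) := by
      constructor
      · intro hd
        rw [hd]
        exact ⟨fun i => rfl, fun j => rfl⟩
      · rintro ⟨h1, h2⟩
        ext (i | j)
        · exact Int.natCast_inj.1 (h1 i)
        · exact Int.natCast_inj.1 (h2 j)
    rw [MvPowerSeries.coeff_monomial, if_congr hiff rfl rfl, Int.coe_castAddHom]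
    split_ifs <;> simp

theorem plethysmCoeffVec_eq_zero_of_neg {n m : ℕ} (mu : YoungDiagram) {γ : Fin n → ℤ}
    {δ : Fin m → ℤ} (h : ∃ x, Sum.elim γ δ x < 0) : plethysmCoeffVec mu γ δ = 0 := by
  refine finsum_eq_zero_of_forall_eq_zero fun p => if_neg ?_
  rintro ⟨h1, h2⟩
  obtain ⟨i | j, hx⟩ := h
  · have := h1 i
    simp only [Sum.elim_inl] at hx
    omega
  · have := h2 j
    simp only [Sum.elim_inr] at hx
    omega

theorem plethysmCoeffVec_sub {n m : ℕ} (mu : YoungDiagram) (d s : Fin n ⊕ Fin m →₀ ℕ)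
    [Decidable (s ≤ d)] :
    (plethysmCoeffVec mu (fun i : Fin n => (d (Sum.inl i) : ℤ) - (s (Sum.inl i) : ℤ))
      (fun j : Fin m => (d (Sum.inr j) : ℤ) - (s (Sum.inr j) : ℤ)) : ℚ) =
      if s ≤ d then MvPowerSeries.coeff (d - s) (plethysmSeries n m mu) else 0 := by
  split_ifs with h
  · rw [← plethysmCoeffVec_natCast]
    congr 2 <;> funext i <;> rw [Finsupp.tsub_apply, Nat.cast_sub (h _)]
  · have hx : ∃ x, d x < s x := by
      by_contra hx
      push Not at hx
      exact h hx
    obtain ⟨x, hx⟩ := hx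
    rw [plethysmCoeffVec_eq_zero_of_neg, Int.cast_zero]
    refine ⟨x, ?_⟩
    rcases x with i | j
    · simp only [Sum.elim_inl]
      omega
    · simp only [Sum.elim_inr]
      omega

open Classical in
theorem coeff_coe_mul {σ : Type*} (Q : MvPolynomial σ ℚ) (F : MvPowerSeries σ ℚ) (d : σ →₀ ℕ) :
    MvPowerSeries.coeff d ((Q : MvPowerSeries σ ℚ) * F) = ∑ s ∈ Q.support,
      MvPolynomial.coeff s Q * if s ≤ d then MvPowerSeries.coeff (d - s) F else 0 := by
  conv_lhs => rw [Q.as_sum]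
  rw [← MvPolynomial.coeToMvPowerSeries.ringHom_apply, map_sum, Finset.sum_mul, map_sum]
  refine Finset.sum_congr rfl fun s _ => ?_
  rw [MvPolynomial.coeToMvPowerSeries.ringHom_apply, MvPolynomial.coe_monomial,
    MvPowerSeries.coeff_monomial_mul]
  split_ifs <;> simp

/-- A rational series gives a linear recurrence for its coefficients: compare coefficients in
`Q F = P`. The only possible exceptional indices are the exponents
of the monomials of `P`. -/
theorem exists_recurrence_plethysmCoeffVec (n m : ℕ) (mu : YoungDiagram) :
    ∃ (S : Finset ((Fin n → ℕ) × (Fin m → ℕ))) (c : (Fin n → ℕ) × (Fin m → ℕ) → ℚ),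
      (0, 0) ∉ S ∧
      {p : (Fin n → ℤ) × (Fin m → ℤ) |
        (plethysmCoeffVec mu p.1 p.2 : ℚ) ≠
          ∑ s ∈ S, c s * (plethysmCoeffVec mu (fun i => p.1 i - (s.1 i : ℤ))
            (fun j => p.2 j - (s.2 j : ℤ)) : ℚ)}.Finite := by
  classical
  obtain ⟨P, Q, hQ, hPQ⟩ := isRationalSeries_plethysmSeries n m mu
  let E : (Fin n ⊕ Fin m →₀ ℕ) ≃ (Fin n → ℕ) × (Fin m → ℕ) :=
    Finsupp.equivFunOnFinite.trans (Equiv.sumArrowEquivProdArrow _ _ _)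
  refine ⟨(Q.support.erase 0).map E.toEmbedding,
    fun s => -(MvPolynomial.coeff (E.symm s) Q / MvPolynomial.constantCoeff Q), ?_, ?_⟩
  · intro h
    obtain ⟨d, hd, hd0⟩ := Finset.mem_map.1 h
    refine (Finset.mem_erase.1 hd).1 (E.injective ?_)
    exact hd0
  refine (P.support.finite_toSet.image fun d : Fin n ⊕ Fin m →₀ ℕ =>
    ((fun i => (d (Sum.inl i) : ℤ), fun j => (d (Sum.inr j) : ℤ)) :
      (Fin n → ℤ) × (Fin m → ℤ))).subset ?_
  rintro ⟨γ, δ⟩ hp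
  by_contra hP
  refine hp ?_
  rw [Finset.sum_map]
  simp only [Equiv.coe_toEmbedding, Equiv.symm_apply_apply]
  by_cases hneg : ∃ x, Sum.elim γ δ x < 0
  · -- All terms vanish, because subtraction keeps a negative coordinate negative.
    rw [plethysmCoeffVec_eq_zero_of_neg mu hneg, Int.cast_zero, Finset.sum_eq_zero]
    intro s _
    rw [plethysmCoeffVec_eq_zero_of_neg mu, Int.cast_zero, mul_zero]
    obtain ⟨i | j, hx⟩ := hneg
    · refine ⟨Sum.inl i, ?_⟩
      simp only [Sum.elim_inl] at hx ⊢
      omega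
    · refine ⟨Sum.inr j, ?_⟩
      simp only [Sum.elim_inr] at hx ⊢
      omega
  · push Not at hneg
    obtain ⟨d, rfl, rfl⟩ : ∃ d : Fin n ⊕ Fin m →₀ ℕ,
        γ = (fun i => (d (Sum.inl i) : ℤ)) ∧ δ = fun j => (d (Sum.inr j) : ℤ) := by
      refine ⟨Finsupp.equivFunOnFinite.symm fun x => (Sum.elim γ δ x).toNat, ?_, ?_⟩
      · funext i
        exact (Int.toNat_of_nonneg (hneg (Sum.inl i))).symm
      · funext j
        exact (Int.toNat_of_nonneg (hneg (Sum.inr j))).symm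
    have hd : d ∉ P.support := fun h => hP ⟨d, h, rfl⟩
    have hcoeff := congrArg (MvPowerSeries.coeff d) hPQ
    have h0 : (0 : Fin n ⊕ Fin m →₀ ℕ) ∈ Q.support := MvPolynomial.mem_support_iff.2 hQ
    rw [MvPolynomial.coeff_coe, MvPolynomial.notMem_support_iff.1 hd, coeff_coe_mul,
      ← Finset.add_sum_erase _ _ h0, if_pos zero_le, tsub_zero] at hcoeff
    have hterm : ∀ s : Fin n ⊕ Fin m →₀ ℕ,
        (plethysmCoeffVec mu (fun i : Fin n => (d (Sum.inl i) : ℤ) - ((E s).1 i : ℤ))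
          (fun j : Fin m => (d (Sum.inr j) : ℤ) - ((E s).2 j : ℤ)) : ℚ) =
        if s ≤ d then MvPowerSeries.coeff (d - s) (plethysmSeries n m mu) else 0 :=
      fun s => plethysmCoeffVec_sub mu d s
    simp only [hterm, plethysmCoeffVec_natCast]
    have hQ' : MvPolynomial.coeff 0 Q = MvPolynomial.constantCoeff Q := rfl
    rw [hQ'] at hcoeff
    have hsum : ∑ s ∈ Q.support.erase 0, -(MvPolynomial.coeff s Q /
        MvPolynomial.constantCoeff Q) * (if s ≤ d then
          MvPowerSeries.coeff (d - s) (plethysmSeries n m mu) else 0) =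
        -((∑ s ∈ Q.support.erase 0, MvPolynomial.coeff s Q * (if s ≤ d then
          MvPowerSeries.coeff (d - s) (plethysmSeries n m mu) else 0)) /
          MvPolynomial.constantCoeff Q) := by
      rw [Finset.sum_div, ← Finset.sum_neg_distrib]
      exact Finset.sum_congr rfl fun s _ => by ring
    rw [hsum]
    field_simp
    linear_combination hcoeff

theorem mainTheorem5 (n m : ℕ) (mu : YoungDiagram) :
    -- the plethysm coefficients are well defined
    (∀ nu : YoungDiagram,
      IsSchurExpansion (schurPlethysm nu mu n) (plethysmCoeff n nu mu) ∧
      ∀ c : PartitionLE n →₀ ℤ,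
        IsSchurExpansion (schurPlethysm nu mu n) c → c = plethysmCoeff n nu mu) ∧
    -- their generating function is rational
    IsRationalSeries (plethysmSeries n m mu) ∧
    -- they satisfy a linear recurrence, with finitely many exceptional indices
    (∃ (S : Finset ((Fin n → ℕ) × (Fin m → ℕ))) (c : (Fin n → ℕ) × (Fin m → ℕ) → ℚ),
      (0, 0) ∉ S ∧
      {p : (Fin n → ℤ) × (Fin m → ℤ) |
        (plethysmCoeffVec mu p.1 p.2 : ℚ) ≠
          ∑ s ∈ S, c s * (plethysmCoeffVec mu (fun i => p.1 i - (s.1 i : ℤ))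
            (fun j => p.2 j - (s.2 j : ℤ)) : ℚ)}.Finite) :=
  ⟨fun nu => ⟨isSchurExpansion_plethysmCoeff n nu mu, fun _ hc => eq_plethysmCoeff hc⟩,
    isRationalSeries_plethysmSeries n m mu, exists_recurrence_plethysmCoeffVec n m mu⟩
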